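/- Let $A=(t_n)_{n\ge 1}$ be a sequence of positive integers. Suppose that there is a strictly increasing sequence $J=(n_k)_{k\ge 1}$ of positive integers of positive lower density, i.e. $\underline d(J)=\liminf_{n\to\infty}\frac{|J\cap[1,n]|}{n}>0$, such that $\lim_{k\to\infty}(t_{n_{k+1}}-t_{n_k})=+\infty$. Then there exists a rank one system $(X,\mathcal B,\mu,T)$ with $h^A(T)=+\infty$. Here $h^A(T)=\sup_\xi h^A(T,\xi)$, the supremum over all finite measurable partitions $\xi$ of $X$, where $$h^A(T,\xi)=\limsup_{n\to\infty}\frac1n H\Big(\bigvee_{k=1}^n T^{-t_k}\xi\Big),\qquad H(\{X_1,\dots,X_m\})=-\sum_{i=1}^m\mu(X_i)\log\mu(X_i),$$ with $0\log 0=0$. A rank one system is an invertible measure-preserving transformation $T$ of a standard Borel probability space $(X,\mathcal B,\mu)$ obtained by cutting and stacking: there are integers $q_n\ge1$ ($n\ge0$), with $q_n\ge2$ infinitely often, and $a_{n,i}\ge0$ ($1\le i\le q_n-1$) such that, with $a_n=\sum_{i=1}^{q_n-1}a_{n,i}$, $h_0=1$ and $h_{n+1}=q_nh_n+a_n$, the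 series $\sum_n a_n/h_{n+1}$ converges; and there are measurable sets $F_n$, $F_{n,i}$ ($1\le i\le q_n$) and $C_{n,i,j}$ ($1\le i\le q_n-1$, $1\le j\le a_{n,i}$) such that for every $n$ 1. the sets $T^kF_n$, $0\le k\le h_n-1$, are pairwise disjoint; 2. $F_n$ is the disjoint union of $F_{n,1},\dots,F_{n,q_n}$; 3. for $1\le i\le q_n-1$, $T^{h_n}F_{n,i}=C_{n,i,1}$ if $a_{n,i}>0$, and $T^{h_n}F_{n,i}=F_{n,i+1}$ if $a_{n,i}=0$; 4. for $1\le i\le q_n-1$, $TC_{n,i,j}=C_{n,i,j+1}$ if $1\le j<a_{n,i}$, and $TC_{n,i,a_{n,i}}=F_{n,i+1}$ if $a_{n,i}>0$; 5. $F_{n+1}=F_{n,1}$; and the towers fill out $X$ and their levels approach the partition into points: for every $B\in\mathcal B$ and $\varepsilon>0$, for all sufficiently large $n$ there is $I\subseteq\{0,\dots,h_n-1\}$ with $\mu\big(B\,\triangle\,\bigcup_{k\in I}T^kF_n\big)<\varepsilon$. -/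

import Mathlib

open MeasureTheory Filter Topology

noncomputable section

/-- A finite measurable partition of `X` with cells labelled by `ι` (empty cells are allowed). -/
structure MeasurablePartition (ι X : Type*) [MeasurableSpace X] where
  cell : ι → Set X
  measurableSet_cell : ∀ i, MeasurableSet (cell i)
  disjoint_cell : Pairwise fun i j => Disjoint (cell i) (cell j)
  iUnion_cell : ⋃ i, cell i = Set.univ

namespace MeasurablePartition

/-- The partition `f⁻¹ ξ`. -/
def pullback {ι X : Type*} [MeasurableSpace X] (ξ : MeasurablePartition ι X)
    (f : X → X) (hf : Measurable f) : MeasurablePartition ι X where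
  cell i := f ⁻¹' ξ.cell i
  measurableSet_cell i := hf (ξ.measurableSet_cell i)
  disjoint_cell _ _ hij := (ξ.disjoint_cell hij).preimage f
  iUnion_cell := by rw [← Set.preimage_iUnion, ξ.iUnion_cell, Set.preimage_univ]

/-- The join of `n` partitions; its cells are the intersections of one cell of each of them. -/
def join {ι X : Type*} [MeasurableSpace X] {n : ℕ} (P : Fin n → MeasurablePartition ι X) :
    MeasurablePartition (Fin n → ι) X where
  cell w := ⋂ k, (P k).cell (w k)
  measurableSet_cell w := MeasurableSet.iInter fun k => (P k).measurableSet_cell (w k)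
  disjoint_cell v w hvw := by
    obtain ⟨k, hk⟩ := Function.ne_iff.mp hvw
    exact ((P k).disjoint_cell hk).mono (Set.iInter_subset _ k) (Set.iInter_subset _ k)
  iUnion_cell := by
    refine Set.eq_univ_of_forall fun x => ?_
    have h : ∀ k, ∃ i, x ∈ (P k).cell i := fun k =>
      Set.mem_iUnion.mp (by rw [(P k).iUnion_cell]; exact Set.mem_univ x)
    choose w hw using h
    exact Set.mem_iUnion.mpr ⟨w, Set.mem_iInter.mpr hw⟩

/-- Shannon entropy `H(ξ) = ∑ᵢ -μ(Xᵢ) log μ(Xᵢ)` (natural logarithm). -/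
def entropy {ι X : Type*} [Fintype ι] [MeasurableSpace X] (μ : Measure X)
    (ξ : MeasurablePartition ι X) : ℝ :=
  ∑ i, Real.negMulLog (μ.real (ξ.cell i))

end MeasurablePartition

/-- The sequence entropy of `T` along `A = (A 0, A 1, …)` with respect to `ξ`:
`limsup (1/n) H(⋁_{k < n} T^{-A k} ξ)`. -/
def seqEntropyPartition {ι X : Type*} [Fintype ι] [MeasurableSpace X] (μ : Measure X)
    (T : X ≃ᵐ X) (A : ℕ → ℕ) (ξ : MeasurablePartition ι X) : EReal :=
  limsup (fun n : ℕ =>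
    (((MeasurablePartition.join fun k : Fin n =>
      ξ.pullback (⇑T)^[A k] (T.measurable.iterate (A k))).entropy μ / n : ℝ) : EReal)) atTop

/-- The sequence entropy of `T` along `A`: the supremum over all finite measurable partitions. -/
def seqEntropy {X : Type*} [MeasurableSpace X] (μ : Measure X) (T : X ≃ᵐ X) (A : ℕ → ℕ) : EReal :=
  ⨆ (m : ℕ) (ξ : MeasurablePartition (Fin m) X), seqEntropyPartition μ T A ξ

/-- The gaps `A (n + 1) - A n` tend to `+∞`. -/
def DilatesToInfinity (A : ℕ → ℕ) : Prop :=
  Tendsto (fun n => (A (n + 1) : ℤ) - (A n : ℤ)) atTop atTop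

/-- The lower (asymptotic) density of a set of natural numbers. -/
def lowerDensity (S : Set ℕ) : ℝ :=
  liminf (fun n : ℕ => ((S ∩ Set.Iio n).ncard : ℝ) / n) atTop

/-- The number of spacer levels added at stage `n`. For a stage with `q n` columns (indexed by
`i < q n`), `a n i` spacers are put on column `i` for `i < q n - 1`, and none on the last one. -/
def spacerCount (q : ℕ → ℕ) (a : ℕ → ℕ → ℕ) (n : ℕ) : ℕ :=
  ∑ i ∈ Finset.range (q n - 1), a n i

/-- The tower heights: `h 0 = 1` and `h (n + 1) = q n * h n + ∑ i, a n i`. -/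
def towerHeight (q : ℕ → ℕ) (a : ℕ → ℕ → ℕ) : ℕ → ℕ
  | 0 => 1
  | n + 1 => q n * towerHeight q a n + spacerCount q a n

/-- `(X, μ, T)` is obtained by cutting and stacking with stacking data `q`, `a`, tower bases `F n`,
subdivisions `E n i` (`i < q n`) of `F n`, and spacer levels `C n i j` (`j < a n i`) above the
column over `E n i`. -/
structure IsCutAndStack {X : Type*} [MeasurableSpace X] (μ : Measure X) (T : X ≃ᵐ X)
    (q : ℕ → ℕ) (a : ℕ → ℕ → ℕ) (F : ℕ → Set X) (E : ℕ → ℕ → Set X)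
    (C : ℕ → ℕ → ℕ → Set X) : Prop where
  q_pos : ∀ n, 1 ≤ q n
  /-- Infinitely many of the cuttings are nontrivial, so that the heights are unbounded. -/
  q_frequently : ∃ᶠ n in atTop, 2 ≤ q n
  summable : Summable fun n => (spacerCount q a n : ℝ) / (towerHeight q a (n + 1) : ℝ)
  measurableSet_base : ∀ n, MeasurableSet (F n)
  measurableSet_sub : ∀ n, ∀ i < q n, MeasurableSet (E n i)
  measurableSet_spacer : ∀ n, ∀ i < q n - 1, ∀ j < a n i, MeasurableSet (C n i j)
  /-- The levels of each tower are pairwise disjoint. -/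
  disjoint_levels : ∀ n, ∀ k < towerHeight q a n, ∀ l < towerHeight q a n, k ≠ l →
    Disjoint ((⇑T)^[k] '' F n) ((⇑T)^[l] '' F n)
  disjoint_sub : ∀ n, ∀ i < q n, ∀ j < q n, i ≠ j → Disjoint (E n i) (E n j)
  union_sub : ∀ n, ⋃ i ∈ Finset.range (q n), E n i = F n
  top_to_spacer : ∀ n, ∀ i < q n - 1, 0 < a n i →
    (⇑T)^[towerHeight q a n] '' E n i = C n i 0
  top_to_sub : ∀ n, ∀ i < q n - 1, a n i = 0 →
    (⇑T)^[towerHeight q a n] '' E n i = E n (i + 1)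
  spacer_to_spacer : ∀ n, ∀ i < q n - 1, ∀ j, j + 1 < a n i → T '' C n i j = C n i (j + 1)
  spacer_to_sub : ∀ n, ∀ i < q n - 1, ∀ j, j + 1 = a n i → T '' C n i j = E n (i + 1)
  base_succ : ∀ n, F (n + 1) = E n 0
  /-- The towers fill out the space and the partitions into their levels approach the partition
  into points: every measurable set is approximated in measure by unions of levels of the `n`-th
  tower as `n → ∞`. -/
  approximates : ∀ B : Set X, MeasurableSet B → ∀ ε : ℝ, 0 < ε → ∃ N, ∀ n ≥ N,
    ∃ I ⊆ Finset.range (towerHeight q a n),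
      μ.real (symmDiff B (⋃ k ∈ I, (⇑T)^[k] '' F n)) < ε

/-- `T` is a measure-preserving transformation of rank one (constructive geometric definition). -/
def IsRankOne {X : Type*} [MeasurableSpace X] (μ : Measure X) (T : X ≃ᵐ X) : Prop :=
  MeasurePreserving T μ μ ∧
    ∃ (q : ℕ → ℕ) (a : ℕ → ℕ → ℕ) (F : ℕ → Set X) (E : ℕ → ℕ → Set X)
      (C : ℕ → ℕ → ℕ → Set X), IsCutAndStack μ T q a F E C

end

/-!
The rank one system is built so that, for infinitely many `N`, the points `T^(A k) x` with `k < N`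
lie in nearly independent places of a tower whenever the times `A k` are far apart.

**The spacers.** Let `g` be the height of the tower of stage `n`. In passing to the next stage the
copies of this tower are stacked into blocks of `Q = 2 ^ (n + 4)` copies without spacers, and the
`i`-th block is put at height `i * P + x i`, where `P = (Q + 1) * g` and `0 ≤ x i < g`. The blocks
are grouped into words of length `W`, and the shifts in the `j`-th word are the `W` digits of `j` in
base `g`, for `j < g ^ W` (`blockShift`, `blockPos`, `sum_blockSpacer`). A point at height
`j * (W * P) + s`, with `j` uniformly distributed, is at time `t` at height `r - x` above the start
of a block, where `s + t = d * P + r` and `x` is the `d`-th digit of `j`, provided that `r` is in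
the window `[g, Q * g)`. As a block is `g`-periodic, the level of the tower of stage `n` visited at
that time is `(r - x) % g`, which is uniformly distributed, and is independent for times with
different `d` (`IsBlockStage.image_level_subset`, `card_digits_mul_le`). The quotients `d` differ if
the times are at least `P` apart.

**The entropy.** Let `ξ` be the partition into the levels of the tower of a fixed stage `m` and the
complement of that tower. Conditioning on `s` does not increase entropy, and for fixed `s` every
time of a separated family at which `r` is in the window `[g, Q * g)` and the point is in the tower
of stage `m` contributes the logarithm of the height of that tower
(`MeasurablePartition.sum_le_entropy`, `IsCutAndStack.le_entropy_join`). By hypothesis a positive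
proportion of the times `A k`, `k < N`, is `P`-separated for some `N` as large as desired
(`exists_separated_times`), and `W` is chosen after `N`, so large that all the times are at most
an eighth of the length of a word. Hence the sequence entropy of `ξ` is at least a constant multiple
of the logarithm of the height of the tower of stage `m`, which is unbounded.

**Realisation of the data.** For spacers of finite total measure the cutting and stacking
transformation is realised on `Ω × ℕ` as a skyscraper over the odometer on the space `Ω` of digit
sequences: above `x` there are as many extra floors as there are spacers on the column determined by
the first digit of `x` that is not the largest one (`Digits.cutStack`, `exists_isCutAndStack`).
-/

noncomputable section

/-! ### The odometer -/

/-- The space of digit sequences `x 0, x 1, …` with `x n ≤ c n`. -/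
abbrev Digits (c : ℕ → ℕ) : Type := ∀ n, Fin (c n + 1)

namespace Digits

variable {c : ℕ → ℕ}

open scoped Classical in
/-- Addition of `1` with carry to the right; the sequence of largest digits is sent to zero. -/
def succ (x : Digits c) : Digits c := fun n =>
  if ∀ k < n, x k = Fin.last _ then x n + 1 else x n

open scoped Classical in
/-- Subtraction of `1` with borrow from the right. -/
def pred (x : Digits c) : Digits c := fun n =>
  if ∀ k < n, x k = 0 then x n - 1 else x n

theorem add_one_eq_zero_iff {m : ℕ} (i : Fin (m + 1)) : i + 1 = 0 ↔ i = Fin.last m := by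
  rw [← Fin.last_add_one, add_left_inj]

/-- Before the carry stops, `succ` turns largest digits, and only these, into zeros; so `pred`
borrows exactly where `succ` carries. -/
theorem succ_eq_zero_iff (x : Digits c) (n : ℕ) :
    (∀ k < n, succ x k = 0) ↔ ∀ k < n, x k = Fin.last _ := by
  induction n with
  | zero => simp
  | succ n ih =>
    rw [Nat.forall_lt_succ_right, Nat.forall_lt_succ_right, ih]
    refine and_congr_right fun h => ?_
    rw [succ, if_pos h, add_one_eq_zero_iff]

theorem pred_eq_last_iff (x : Digits c) (n : ℕ) :
    (∀ k < n, pred x k = Fin.last _) ↔ ∀ k < n, x k = 0 := by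
  induction n with
  | zero => simp
  | succ n ih =>
    rw [Nat.forall_lt_succ_right, Nat.forall_lt_succ_right, ih]
    refine and_congr_right fun h => ?_
    rw [pred, if_pos h, ← add_one_eq_zero_iff, sub_add_cancel]

theorem pred_succ (x : Digits c) : pred (succ x) = x := by
  funext n
  by_cases h : ∀ k < n, x k = Fin.last _
  · rw [pred, if_pos ((succ_eq_zero_iff x n).2 h), succ, if_pos h, add_sub_cancel_right]
  · rw [pred, if_neg (mt (succ_eq_zero_iff x n).1 h), succ, if_neg h]

theorem succ_pred (x : Digits c) : succ (pred x) = x := by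
  funext n
  by_cases h : ∀ k < n, x k = 0
  · rw [succ, if_pos ((pred_eq_last_iff x n).2 h), pred, if_pos h, sub_add_cancel]
  · rw [succ, if_neg (mt (pred_eq_last_iff x n).1 h), pred, if_neg h]

theorem measurable_succ : Measurable (succ : Digits c → Digits c) := by
  refine measurable_pi_lambda _ fun n => ?_
  have h : MeasurableSet {x : Digits c | ∀ k < n, x k = Fin.last _} := by
    simp only [Set.ofPred_forall]
    exact MeasurableSet.iInter fun k => MeasurableSet.iInter fun _ =>
      measurable_pi_apply k (measurableSet_singleton _)
  exact Measurable.ite h ((measurable_of_countable fun i : Fin (c n + 1) => i + 1).comp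
    (measurable_pi_apply n)) (measurable_pi_apply n)

theorem measurable_pred : Measurable (pred : Digits c → Digits c) := by
  refine measurable_pi_lambda _ fun n => ?_
  have h : MeasurableSet {x : Digits c | ∀ k < n, x k = 0} := by
    simp only [Set.ofPred_forall]
    exact MeasurableSet.iInter fun k => MeasurableSet.iInter fun _ =>
      measurable_pi_apply k (measurableSet_singleton _)
  exact Measurable.ite h ((measurable_of_countable fun i : Fin (c n + 1) => i - 1).comp
    (measurable_pi_apply n)) (measurable_pi_apply n)

/-- The odometer. -/
def odometer (c : ℕ → ℕ) : Digits c ≃ᵐ Digits c where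
  toFun := succ
  invFun := pred
  left_inv := pred_succ
  right_inv := succ_pred
  measurable_toFun := measurable_succ
  measurable_invFun := measurable_pred

theorem succ_congr {x y : Digits c} {n : ℕ} (h : ∀ k < n, x k = y k) :
    ∀ k < n, succ x k = succ y k := by
  intro k hk
  have : (∀ l < k, x l = Fin.last _) ↔ ∀ l < k, y l = Fin.last _ :=
    forall₂_congr fun l hl => by rw [h l (hl.trans hk)]
  simp only [succ, this, h k hk]

theorem pred_congr {x y : Digits c} {n : ℕ} (h : ∀ k < n, x k = y k) :
    ∀ k < n, pred x k = pred y k := by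
  intro k hk
  have : (∀ l < k, x l = 0) ↔ ∀ l < k, y l = 0 :=
    forall₂_congr fun l hl => by rw [h l (hl.trans hk)]
  simp only [pred, this, h k hk]

/-- The sequences whose first `n` digits are those of `w`. -/
def cyl (w : Digits c) (n : ℕ) : Set (Digits c) := {x | ∀ k < n, x k = w k}

theorem measurableSet_cyl (w : Digits c) (n : ℕ) : MeasurableSet (cyl w n) := by
  simp only [cyl, Set.ofPred_forall]
  exact MeasurableSet.iInter fun k => MeasurableSet.iInter fun _ =>
    measurable_pi_apply k (measurableSet_singleton _)

theorem succ_preimage_cyl (w : Digits c) (n : ℕ) : succ ⁻¹' cyl w n = cyl (pred w) n := by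
  ext x
  constructor
  · intro h
    have := pred_congr h
    rwa [pred_succ] at this
  · intro h
    have := succ_congr h
    rwa [succ_pred] at this

theorem isPiSystem_cyl : IsPiSystem {s : Set (Digits c) | ∃ w n, s = cyl w n} := by
  rintro _ ⟨w, n, rfl⟩ _ ⟨v, m, rfl⟩ ⟨y, hy, hy'⟩
  refine ⟨y, max n m, Set.ext fun x =>
    ⟨fun ⟨h, h'⟩ k hk => ?_, fun h => ⟨fun k hk => ?_, fun k hk => ?_⟩⟩⟩
  · rcases lt_max_iff.1 hk with hk | hk
    · rw [h k hk, hy k hk]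
    · rw [h' k hk, hy' k hk]
  · rw [h k (lt_max_of_lt_left hk), hy k hk]
  · rw [h k (lt_max_of_lt_right hk), hy' k hk]

theorem generateFrom_cyl :
    (MeasurableSpace.pi : MeasurableSpace (Digits c)) =
      MeasurableSpace.generateFrom {s | ∃ w n, s = cyl w n} := by
  apply le_antisymm
  · refine iSup_le fun n => ?_
    rintro _ ⟨s, -, rfl⟩
    let extend : (∀ k : Fin (n + 1), Fin (c k + 1)) → Digits c := fun u k =>
      if h : k < n + 1 then u ⟨k, h⟩ else 0
    have : (fun x : Digits c => x n) ⁻¹' s =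
        ⋃ u ∈ {u : ∀ k : Fin (n + 1), Fin (c k + 1) | u (Fin.last n) ∈ s},
          cyl (extend u) (n + 1) := by
      ext x
      simp only [Set.mem_preimage, Set.mem_iUnion, Set.mem_ofPred_eq, exists_prop]
      constructor
      · intro hx
        exact ⟨fun k => x k, hx, fun k hk => by change x k = dite _ _ _; rw [dif_pos hk]⟩
      · rintro ⟨u, hu, hx⟩
        have := hx n (Nat.lt_succ_self n)
        simp only [extend, Nat.lt_succ_self, dif_pos] at this
        rw [this]
        exact hu
    rw [this]
    exact @MeasurableSet.biUnion _ _ (MeasurableSpace.generateFrom _) _ _ (Set.to_countable _)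
      fun u _ => MeasurableSpace.measurableSet_generateFrom ⟨_, _, rfl⟩
  · refine MeasurableSpace.generateFrom_le ?_
    rintro _ ⟨w, n, rfl⟩
    exact measurableSet_cyl w n

/-- The product of the uniform distributions of the digits. -/
def unif (c : ℕ → ℕ) : Measure (Digits c) :=
  Measure.infinitePi fun _ => ProbabilityTheory.uniformOn Set.univ

instance (m : ℕ) : IsProbabilityMeasure
    (ProbabilityTheory.uniformOn (Set.univ : Set (Fin (m + 1)))) :=
  ProbabilityTheory.isProbabilityMeasure_uniformOn Set.finite_univ Set.univ_nonempty

instance : IsProbabilityMeasure (unif c) := by unfold unif; infer_instance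

theorem unif_cyl (w : Digits c) (n : ℕ) :
    unif c (cyl w n) = (∏ k ∈ Finset.range n, ((c k + 1 : ℕ) : ENNReal))⁻¹ := by
  have h : cyl w n = Set.pi (Finset.range n : Set ℕ) fun k => {w k} := by
    ext x; simp [cyl, Set.mem_pi]
  rw [h, unif, Measure.infinitePi_pi _ (fun _ _ => measurableSet_singleton _),
    ENNReal.prod_inv_distrib]
  · refine Finset.prod_congr rfl fun k _ => ?_
    rw [ProbabilityTheory.uniformOn_univ]
    simp
  · intro i _ j _ _
    exact Or.inl (by simp)

theorem measurePreserving_odometer : MeasurePreserving (odometer c) (unif c) (unif c) := by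
  refine ⟨(odometer c).measurable, ?_⟩
  have : IsProbabilityMeasure ((unif c).map (odometer c)) :=
    Measure.isProbabilityMeasure_map (odometer c).measurable.aemeasurable
  refine ext_of_generate_finite _ generateFrom_cyl isPiSystem_cyl ?_ (by simp)
  rintro _ ⟨w, n, rfl⟩
  rw [Measure.map_apply (odometer c).measurable (measurableSet_cyl w n)]
  change unif c (succ ⁻¹' cyl w n) = _
  rw [succ_preimage_cyl, unif_cyl, unif_cyl]

end Digits

/-! ### Skyscrapers -/

namespace Skyscraper

variable {Ω : Type*} [MeasurableSpace Ω]

/-- One step up in the skyscraper with `e x` floors above the ground floor over `x`; from the top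
floor one descends to the ground floor over `S x`. Points above the top floor are fixed. -/
def up (S : Ω ≃ᵐ Ω) (e : Ω → ℕ) (p : Ω × ℕ) : Ω × ℕ :=
  if p.2 < e p.1 then (p.1, p.2 + 1) else if p.2 = e p.1 then (S p.1, 0) else p

/-- One step down in the skyscraper. -/
def down (S : Ω ≃ᵐ Ω) (e : Ω → ℕ) (p : Ω × ℕ) : Ω × ℕ :=
  if p.2 = 0 then (S.symm p.1, e (S.symm p.1)) else
    if p.2 ≤ e p.1 then (p.1, p.2 - 1) else p

variable {S : Ω ≃ᵐ Ω} {e : Ω → ℕ}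

theorem up_of_lt {x : Ω} {j : ℕ} (h : j < e x) : up S e (x, j) = (x, j + 1) := if_pos h

theorem up_top (x : Ω) : up S e (x, e x) = (S x, 0) := by simp [up]

theorem down_up (p : Ω × ℕ) : down S e (up S e p) = p := by
  obtain ⟨x, j⟩ := p
  rcases lt_trichotomy j (e x) with h | h | h
  · rw [up_of_lt h]
    simp [down, h]
  · subst h
    simp [up_top, down]
  · have : up S e (x, j) = (x, j) := by simp [up, h.not_gt, h.ne']
    rw [this]
    simp [down, (Nat.zero_le _).trans_lt h |>.ne', h.not_ge]

theorem up_down (p : Ω × ℕ) : up S e (down S e p) = p := by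
  obtain ⟨x, j⟩ := p
  rcases j with _ | j
  · simp [down, up]
  · by_cases h : j + 1 ≤ e x
    · have : down S e (x, j + 1) = (x, j) := by simp [down, h]
      rw [this, up_of_lt (Nat.lt_of_succ_le h)]
    · have : down S e (x, j + 1) = (x, j + 1) := by simp [down, h]
      rw [this]
      have h1 : ¬ j + 1 < e x := by omega
      have h2 : ¬ j + 1 = e x := by omega
      simp [up, h1, h2]

theorem measurable_up (he : Measurable e) : Measurable (up S e) := by
  unfold up
  refine Measurable.ite (measurableSet_lt measurable_snd (he.comp measurable_fst)) (by fun_prop)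
    (Measurable.ite (measurableSet_eq_fun measurable_snd (he.comp measurable_fst)) ?_ measurable_id)
  exact (S.measurable.comp measurable_fst).prodMk measurable_const

theorem measurable_down (he : Measurable e) : Measurable (down S e) := by
  unfold down
  have hs : Measurable fun p : Ω × ℕ => S.symm p.1 := S.symm.measurable.comp measurable_fst
  refine Measurable.ite (measurableSet_eq_fun measurable_snd measurable_const)
    (hs.prodMk (he.comp hs))
    (Measurable.ite (measurableSet_le measurable_snd (he.comp measurable_fst)) ?_ measurable_id)
  exact measurable_fst.prodMk ((measurable_of_countable fun j : ℕ => j - 1).comp measurable_snd)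

/-- The skyscraper over `S` with `e x` floors above the ground floor over `x`, acting on all of
`Ω × ℕ`; it is the identity on the points `(x, j)` with `j > e x`. -/
def equiv (S : Ω ≃ᵐ Ω) (e : Ω → ℕ) (he : Measurable e) : Ω × ℕ ≃ᵐ Ω × ℕ where
  toFun := up S e
  invFun := down S e
  left_inv := down_up
  right_inv := up_down
  measurable_toFun := measurable_up he
  measurable_invFun := measurable_down he

/-- The measure on the floors `j ≤ e x` that restricts to a copy of `P` on each of them. -/
def floorMeasure (P : Measure Ω) (e : Ω → ℕ) : Measure (Ω × ℕ) :=
  Measure.sum fun j => (P.restrict {x | j ≤ e x}).map fun x => (x, j)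

theorem floorMeasure_apply (P : Measure Ω) {B : Set (Ω × ℕ)}
    (hB : MeasurableSet B) :
    floorMeasure P e B = ∑' j, P {x | (x, j) ∈ B ∧ j ≤ e x} := by
  rw [floorMeasure, Measure.sum_apply _ hB]
  refine tsum_congr fun j => ?_
  have hj : Measurable fun x : Ω => (x, j) := measurable_id.prodMk measurable_const
  rw [Measure.map_apply hj hB, Measure.restrict_apply (hj hB)]
  rfl

/-- One step up shifts the part of a floor below the top onto the next floor; the top floors
together form a copy of the base, which `S` maps to the ground floor. -/
theorem floorMeasure_preserving {P : Measure Ω} (he : Measurable e)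
    (hS : MeasurePreserving S P P) :
    MeasurePreserving (equiv S e he) (floorMeasure P e) (floorMeasure P e) := by
  refine ⟨(equiv S e he).measurable, Measure.ext fun B hB => ?_⟩
  have hm : ∀ j : ℕ, Measurable fun x : Ω => (x, j) := fun j =>
    measurable_id.prodMk measurable_const
  rw [Measure.map_apply (equiv S e he).measurable hB, floorMeasure_apply P hB,
    floorMeasure_apply P ((equiv S e he).measurable hB)]
  have hlt : ∀ j, MeasurableSet {x | j < e x} := fun j => measurableSet_lt measurable_const he
  have heq : ∀ j, MeasurableSet {x | e x = j} := fun j => he (measurableSet_singleton j)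
  have hB' : ∀ j, MeasurableSet {x | (x, j) ∈ B} := fun j => hm j hB
  have hSB : MeasurableSet {x | (S x, 0) ∈ B} := S.measurable (hB' 0)
  have split : ∀ j, P {x | (x, j) ∈ equiv S e he ⁻¹' B ∧ j ≤ e x} =
      P {x | (x, j + 1) ∈ B ∧ j + 1 ≤ e x} + P ({x | (S x, 0) ∈ B} ∩ {x | e x = j}) := by
    intro j
    rw [← measure_union _ (hSB.inter (heq j))]
    · congr 1
      ext x
      simp only [Set.mem_ofPred_eq, Set.mem_preimage, Set.mem_union, Set.mem_inter_iff]
      change up S e (x, j) ∈ B ∧ _ ↔ _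
      rcases lt_trichotomy j (e x) with h | h | h
      · rw [up_of_lt h]
        simp [h.le, Nat.succ_le_of_lt h, h.ne']
      · subst h
        simp [up_top]
      · simp [h.not_ge, h.ne, show ¬ j + 1 ≤ e x by omega]
    · rw [Set.disjoint_left]
      rintro x ⟨-, hx⟩ ⟨-, hx'⟩
      simp only [Set.mem_ofPred_eq] at hx'
      omega
  simp_rw [split]
  rw [ENNReal.tsum_add, tsum_eq_zero_add' (f := fun j => P {x | (x, j) ∈ B ∧ j ≤ e x})
    ENNReal.summable, add_comm]
  congr 1
  rw [← measure_iUnion]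
  · rw [← Set.inter_iUnion]
    have : (⋃ i, {x | e x = i}) = Set.univ := by ext; simp
    rw [this, Set.inter_univ]
    have := hS.measure_preimage (hB' 0).nullMeasurableSet
    simpa using this
  · intro i j hij
    rw [Function.onFun, Set.disjoint_left]
    rintro x ⟨-, hx⟩ ⟨-, hx'⟩
    exact hij (hx.symm.trans hx')
  · exact fun j => hSB.inter (heq j)

end Skyscraper

/-! ### Iterates of a measurable equivalence -/

theorem measurableSet_iterate_image {X : Type*} [MeasurableSpace X] (T : X ≃ᵐ X) (k : ℕ) {s : Set X}
    (hs : MeasurableSet s) : MeasurableSet ((⇑T)^[k] '' s) := by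
  induction k with
  | zero => simpa using hs
  | succ k ih =>
    rw [Function.iterate_succ', Set.image_comp]
    exact T.measurableSet_image.2 ih

theorem iterate_image_iterate_image {X : Type*} (f : X → X) (k l : ℕ) (s : Set X) :
    f^[k] '' (f^[l] '' s) = f^[k + l] '' s := by
  rw [Function.iterate_add, Set.image_comp]

theorem measure_iterate_image {X : Type*} [MeasurableSpace X] {μ : Measure X} {T : X ≃ᵐ X}
    (hT : MeasurePreserving T μ μ) (k : ℕ) {s : Set X} (hs : MeasurableSet s) :
    μ ((⇑T)^[k] '' s) = μ s := by
  have h := (hT.iterate k).measure_preimage (measurableSet_iterate_image T k hs).nullMeasurableSet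
  rwa [Set.preimage_image_eq _ (T.injective.iterate k), eq_comm] at h

/-! ### The cutting and stacking transformation -/

/-- The height, in the tower of stage `n + 1`, at which the `l`-th column of stage `n` starts. -/
def columnPos (q : ℕ → ℕ) (a : ℕ → ℕ → ℕ) (n l : ℕ) : ℕ :=
  ∑ i ∈ Finset.range l, (towerHeight q a n + a n i)

section columnPos

variable {q : ℕ → ℕ} {a : ℕ → ℕ → ℕ}

theorem columnPos_zero (n : ℕ) : columnPos q a n 0 = 0 := by simp [columnPos]

theorem columnPos_succ (n l : ℕ) :
    columnPos q a n (l + 1) = columnPos q a n l + (towerHeight q a n + a n l) := by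
  simp [columnPos, Finset.sum_range_succ]

theorem columnPos_mono (n : ℕ) : Monotone (columnPos q a n) :=
  monotone_nat_of_le_succ fun l => by rw [columnPos_succ]; omega

theorem columnPos_last {n : ℕ} (hq : 1 ≤ q n) :
    columnPos q a n (q n - 1) + towerHeight q a n = towerHeight q a (n + 1) := by
  obtain ⟨d, hd⟩ : ∃ d, q n = d + 1 := ⟨q n - 1, by omega⟩
  simp only [columnPos, towerHeight, spacerCount, hd, Finset.sum_add_distrib, Finset.sum_const,
    Finset.card_range, smul_eq_mul, Nat.add_sub_cancel]
  ring

theorem towerHeight_pos (hq : ∀ n, 1 ≤ q n) (n : ℕ) : 0 < towerHeight q a n := by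
  induction n with
  | zero => simp [towerHeight]
  | succ n ih => rw [← columnPos_last (hq n)]; omega

theorem tendsto_towerHeight (hq : ∀ n, 1 ≤ q n) (hfreq : ∃ᶠ n in atTop, 2 ≤ q n) :
    Tendsto (towerHeight q a) atTop atTop := by
  have hmul : ∀ n, q n * towerHeight q a n ≤ towerHeight q a (n + 1) := fun n =>
    Nat.le_add_right _ _
  have hmono : Monotone (towerHeight q a) := monotone_nat_of_le_succ fun n =>
    (Nat.le_mul_of_pos_left _ (hq n)).trans (hmul n)
  refine tendsto_atTop_atTop_of_monotone hmono fun M => ?_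
  induction M with
  | zero => exact ⟨0, Nat.zero_le _⟩
  | succ M ih =>
    obtain ⟨n, hn⟩ := ih
    obtain ⟨m, hm, hm2⟩ := frequently_atTop.1 hfreq n
    refine ⟨m + 1, ?_⟩
    have h1 := hmono hm
    have h2 := hmul m
    have h3 := towerHeight_pos (a := a) hq m
    nlinarith

end columnPos

namespace Digits

variable {c : ℕ → ℕ} {a : ℕ → ℕ → ℕ}

open scoped Classical in
/-- The number of spacers above `x`: it is `a n (x n)` if `n` is the index of the first digit of `x`
that is not the largest one, and `0` if there is none. -/
def extra (a : ℕ → ℕ → ℕ) (x : Digits c) : ℕ :=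
  if h : ∃ n, x n ≠ Fin.last _ then a (Nat.find h) (x (Nat.find h)) else 0

theorem extra_eq {x : Digits c} {n : ℕ} (h : ∀ k < n, x k = Fin.last _) (hn : x n ≠ Fin.last _) :
    extra a x = a n (x n) := by
  classical
  have hex : ∃ n, x n ≠ Fin.last _ := ⟨n, hn⟩
  have : Nat.find hex = n := (Nat.find_eq_iff hex).2 ⟨hn, fun k hk => not_not.2 (h k hk)⟩
  rw [extra, dif_pos hex, this]

theorem exists_first_of_extra_pos {x : Digits c} (h : 0 < extra a x) :
    ∃ n, (∀ k < n, x k = Fin.last _) ∧ x n ≠ Fin.last _ := by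
  classical
  by_cases hex : ∃ n, x n ≠ Fin.last _
  · exact ⟨Nat.find hex, fun k hk => not_not.1 (Nat.find_min hex hk), Nat.find_spec hex⟩
  · simp [extra, hex] at h

theorem measurable_extra : Measurable (extra a : Digits c → ℕ) := by
  refine measurable_of_Ioi fun m => ?_
  have : extra a ⁻¹' Set.Ioi m = ⋃ n, {x : Digits c | (∀ k < n, x k = Fin.last _) ∧
      x n ∈ {i : Fin (c n + 1) | i ≠ Fin.last _ ∧ m < a n i}} := by
    ext x
    simp only [Set.mem_preimage, Set.mem_Ioi, Set.mem_iUnion, Set.mem_ofPred_eq]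
    constructor
    · intro hx
      obtain ⟨n, hn, hn'⟩ := exists_first_of_extra_pos ((Nat.zero_le m).trans_lt hx)
      exact ⟨n, hn, hn', by rwa [extra_eq hn hn'] at hx⟩
    · rintro ⟨n, hn, hn', hx⟩
      rwa [extra_eq hn hn']
  rw [this]
  refine MeasurableSet.iUnion fun n => ?_
  exact (measurableSet_cyl (fun _ => Fin.last _) n).inter
    (measurable_pi_apply (X := fun n => Fin (c n + 1)) n
      (Set.toFinite {i : Fin (c n + 1) | i ≠ Fin.last _ ∧ m < a n i}).measurableSet)

/-- The cutting and stacking transformation with `c n + 1` columns at stage `n` and spacers `a`,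
realised as a skyscraper over the odometer. -/
def cutStack (c : ℕ → ℕ) (a : ℕ → ℕ → ℕ) : Digits c × ℕ ≃ᵐ Digits c × ℕ :=
  Skyscraper.equiv (odometer c) (extra a) measurable_extra

theorem cutStack_iterate_of_le {x : Digits c} {j : ℕ} (h : j ≤ extra a x) :
    (⇑(cutStack c a))^[j] (x, 0) = (x, j) := by
  induction j with
  | zero => rfl
  | succ j ih =>
    rw [Function.iterate_succ_apply', ih (Nat.le_of_succ_le h)]
    exact Skyscraper.up_of_lt (Nat.lt_of_succ_le h)

theorem cutStack_iterate_extra (x : Digits c) :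
    (⇑(cutStack c a))^[extra a x + 1] (x, 0) = (succ x, 0) := by
  rw [Function.iterate_succ_apply', cutStack_iterate_of_le le_rfl]
  exact Skyscraper.up_top x

/-- The digits of `v` below `n` and those of `x` from `n` on. -/
def patch (v : Digits c) (n : ℕ) (x : Digits c) : Digits c := fun k => if k < n then v k else x k

theorem patch_of_lt {v x : Digits c} {n k : ℕ} (h : k < n) : patch v n x k = v k := if_pos h

theorem patch_of_le {v x : Digits c} {n k : ℕ} (h : n ≤ k) : patch v n x k = x k :=
  if_neg h.not_gt

theorem patch_congr {v x y : Digits c} {n : ℕ} (h : ∀ k, n ≤ k → x k = y k) :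
    patch v n x = patch v n y := by
  funext k
  rcases lt_or_ge k n with hk | hk
  · rw [patch_of_lt hk, patch_of_lt hk]
  · rw [patch_of_le hk, patch_of_le hk, h k hk]

theorem patch_self_of {v x : Digits c} {n : ℕ} (h : ∀ k < n, x k = v k) : patch v n x = x := by
  funext k
  rcases lt_or_ge k n with hk | hk
  · rw [patch_of_lt hk, h k hk]
  · rw [patch_of_le hk]

/-- The sequence of largest digits. -/
def top : Digits c := fun _ => Fin.last _

theorem patch_top_of_lt {x : Digits c} {n k : ℕ} (h : k < n) : patch top n x k = Fin.last _ :=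
  patch_of_lt h

theorem succ_patch_top {x : Digits c} {n : ℕ} (hn : x n ≠ Fin.last _) :
    succ (patch top n x) = patch 0 n (Function.update x n (x n + 1)) := by
  funext k
  rcases lt_trichotomy k n with hk | rfl | hk
  · rw [succ, if_pos fun l hl => patch_top_of_lt (hl.trans hk), patch_of_lt hk, patch_of_lt hk]
    exact Fin.last_add_one _
  · rw [succ, if_pos fun l hl => patch_top_of_lt hl, patch_of_le le_rfl, patch_of_le le_rfl,
      Function.update_self]
  · rw [succ, if_neg, patch_of_le hk.le, patch_of_le hk.le, Function.update_of_ne hk.ne']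
    intro h
    exact hn ((patch_of_le le_rfl).symm.trans (h n hk))

theorem extra_patch_top {x : Digits c} {n : ℕ} (hn : x n ≠ Fin.last _) :
    extra a (patch top n x) = a n (x n) := by
  have h : patch top n x n = x n := patch_of_le le_rfl
  rw [extra_eq (n := n) (fun k hk => patch_top_of_lt hk) (by rwa [h]), h]

/-- The height of the tower of stage `n` over `Digits c`. -/
abbrev height (c : ℕ → ℕ) (a : ℕ → ℕ → ℕ) (n : ℕ) : ℕ := towerHeight (fun n => c n + 1) a n

/-- The position of the column `l` of stage `n` in the tower of stage `n + 1`. -/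
abbrev pos (c : ℕ → ℕ) (a : ℕ → ℕ → ℕ) (n l : ℕ) : ℕ := columnPos (fun n => c n + 1) a n l

theorem height_pos (n : ℕ) : 0 < height c a n := towerHeight_pos (fun _ => Nat.succ_pos _) n

theorem pos_last (n : ℕ) : pos c a n (c n) + height c a n = height c a (n + 1) :=
  columnPos_last (q := fun n => c n + 1) (Nat.succ_pos _)

/-- From the base of a column of stage `n` one passes through the column and its spacers to the base
of the next column. The hypothesis is the statement of `iterate_height_sub_one` for `n`. -/
theorem iterate_height_add_of {n : ℕ}
    (ih : ∀ x : Digits c,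
      (⇑(cutStack c a))^[height c a n - 1] (patch 0 n x, 0) = (patch top n x, 0))
    {x : Digits c} (hn : x n ≠ Fin.last _) :
    (⇑(cutStack c a))^[height c a n + a n (x n)] (patch 0 n x, 0) =
      (patch 0 n (Function.update x n (x n + 1)), 0) := by
  have h := height_pos (c := c) (a := a) n
  rw [show height c a n + a n (x n) = extra a (patch top n x) + 1 + (height c a n - 1) by
    rw [extra_patch_top hn]; omega, Function.iterate_add_apply, ih, cutStack_iterate_extra,
    succ_patch_top hn]

/-- The base of a column of stage `n`, seen from the base of the tower of stage `n + 1`. -/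
theorem iterate_pos_of {n : ℕ}
    (ih : ∀ x : Digits c,
      (⇑(cutStack c a))^[height c a n - 1] (patch 0 n x, 0) = (patch top n x, 0))
    (x : Digits c) :
    (⇑(cutStack c a))^[pos c a n (x n)] (patch 0 (n + 1) x, 0) = (patch 0 n x, 0) := by
  obtain ⟨l, hl⟩ : ∃ l, l = (x n : ℕ) := ⟨_, rfl⟩
  rw [← hl]
  induction l generalizing x with
  | zero =>
    have h0 : x n = 0 := Fin.ext hl.symm
    rw [pos, columnPos_zero, Function.iterate_zero, id]
    congr 1
    funext k
    rcases lt_trichotomy k n with hk | rfl | hk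
    · rw [patch_of_lt (hk.trans (Nat.lt_succ_self n)), patch_of_lt hk]
    · rw [patch_of_lt (Nat.lt_succ_self k), patch_of_le le_rfl, h0]; rfl
    · rw [patch_of_le hk, patch_of_le hk.le]
  | succ l ihl =>
    have hlt : l < c n := by have := (x n).isLt; omega
    let i : Fin (c n + 1) := ⟨l, by omega⟩
    let y : Digits c := Function.update x n i
    have hy : y n = i := Function.update_self ..
    have hi : i ≠ Fin.last _ := fun h => hlt.ne (congrArg Fin.val h)
    have hi1 : i + 1 = x n := by
      apply Fin.ext
      rw [Fin.val_add_one_of_lt (Fin.lt_last_iff_ne_last.2 hi), ← hl]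
    have e1 : patch 0 (n + 1) x = patch 0 (n + 1) y :=
      patch_congr fun k hk => (Function.update_of_ne (by omega) _ _).symm
    have e2 := iterate_height_add_of ih (x := y) (by rwa [hy])
    have e3 : Function.update y n (y n + 1) = x := by
      rw [hy, hi1, Function.update_idem, Function.update_eq_self]
    rw [pos, columnPos_succ, add_comm, Function.iterate_add_apply, e1, ihl y (by rw [hy])]
    rw [e3, hy] at e2
    exact e2

/-- The point of the top level of the tower of stage `n` above a given point of its base. -/
theorem iterate_height_sub_one (n : ℕ) (x : Digits c) :
    (⇑(cutStack c a))^[height c a n - 1] (patch 0 n x, 0) = (patch top n x, 0) := by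
  induction n generalizing x with
  | zero =>
    have h : ∀ v : Digits c, patch v 0 x = x := fun v => patch_self_of (by simp)
    rw [h, h]
    rfl
  | succ n ih =>
    let y : Digits c := Function.update x n (Fin.last _)
    have hy : y n = Fin.last _ := Function.update_self ..
    have e1 : patch 0 (n + 1) x = patch 0 (n + 1) y :=
      patch_congr fun k hk => (Function.update_of_ne (by omega) _ _).symm
    have e2 := iterate_pos_of ih y
    rw [hy, Fin.val_last] at e2
    have h := height_pos (c := c) (a := a) n
    rw [← pos_last, show pos c a n (c n) + height c a n - 1 =
      height c a n - 1 + pos c a n (c n) by omega, Function.iterate_add_apply, e1, e2, ih]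
    congr 1
    funext k
    rcases lt_trichotomy k n with hk | rfl | hk
    · rw [patch_of_lt (hk.trans (Nat.lt_succ_self n)), patch_of_lt hk]
    · rw [patch_of_lt (Nat.lt_succ_self k), patch_of_le le_rfl, hy]; rfl
    · rw [patch_of_le hk, patch_of_le hk.le]
      exact Function.update_of_ne hk.ne' _ _

theorem iterate_height_add {n : ℕ} {x : Digits c} (hn : x n ≠ Fin.last _) :
    (⇑(cutStack c a))^[height c a n + a n (x n)] (patch 0 n x, 0) =
      (patch 0 n (Function.update x n (x n + 1)), 0) :=
  iterate_height_add_of (iterate_height_sub_one n) hn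

theorem iterate_pos (n : ℕ) (x : Digits c) :
    (⇑(cutStack c a))^[pos c a n (x n)] (patch 0 (n + 1) x, 0) = (patch 0 n x, 0) :=
  iterate_pos_of (iterate_height_sub_one n) x

/-- The height of a point of the ground floor in the tower of stage `n`. -/
theorem iterate_word (n : ℕ) (x : Digits c) :
    (⇑(cutStack c a))^[∑ k ∈ Finset.range n, pos c a k (x k)] (patch 0 n x, 0) = (x, 0) := by
  induction n with
  | zero =>
    rw [patch_self_of (by simp)]
    rfl
  | succ n ih =>
    rw [Finset.sum_range_succ, Function.iterate_add_apply, iterate_pos, ih]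

theorem sum_pos_lt (n : ℕ) (x : Digits c) :
    ∑ k ∈ Finset.range n, pos c a k (x k) < height c a n := by
  induction n with
  | zero => simp [towerHeight]
  | succ n ih =>
    rw [Finset.sum_range_succ, ← pos_last]
    have : pos c a n (x n) ≤ pos c a n (c n) := columnPos_mono n (Nat.le_of_lt_succ (x n).isLt)
    omega

/-- The base of the tower of stage `n`. -/
def base (c : ℕ → ℕ) (n : ℕ) : Set (Digits c × ℕ) := {p | p.2 = 0 ∧ ∀ k < n, p.1 k = 0}

/-- The base of the `i`-th column of stage `n`. -/
def columnBase (c : ℕ → ℕ) (n i : ℕ) : Set (Digits c × ℕ) :=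
  {p | p.2 = 0 ∧ (∀ k < n, p.1 k = 0) ∧ (p.1 n : ℕ) = i}

theorem measurableSet_prod_zero {s : Set (Digits c)} (hs : MeasurableSet s) :
    MeasurableSet {p : Digits c × ℕ | p.2 = 0 ∧ p.1 ∈ s} :=
  (measurable_snd (measurableSet_singleton 0)).inter (measurable_fst hs)

theorem measurableSet_base (n : ℕ) : MeasurableSet (base c n) :=
  measurableSet_prod_zero (measurableSet_cyl 0 n)

theorem measurableSet_columnBase (n i : ℕ) : MeasurableSet (columnBase c n i) :=
  measurableSet_prod_zero (s := cyl 0 n ∩ {x | (x n : ℕ) = i}) <|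
    (measurableSet_cyl 0 n).inter
      (measurable_pi_apply (X := fun n => Fin (c n + 1)) n
        (Set.toFinite {j : Fin (c n + 1) | (j : ℕ) = i}).measurableSet)

theorem image_columnBase {n i : ℕ} (hi : i < c n) :
    (⇑(cutStack c a))^[height c a n + a n i] '' columnBase c n i = columnBase c n (i + 1) := by
  ext ⟨y, j⟩
  constructor
  · rintro ⟨⟨x, _⟩, ⟨rfl, hx, hxi⟩, h⟩
    dsimp only at hx hxi
    have hn : x n ≠ Fin.last _ := fun h => by rw [h, Fin.val_last] at hxi; omega
    have h1 := iterate_height_add (a := a) hn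
    rw [patch_self_of (v := 0) hx, hxi, h] at h1
    rw [h1]
    refine ⟨rfl, fun k hk => patch_of_lt hk, ?_⟩
    dsimp only
    rw [patch_of_le le_rfl, Function.update_self,
      Fin.val_add_one_of_lt (Fin.lt_last_iff_ne_last.2 hn), hxi]
  · rintro ⟨hj, hy, hyi⟩
    dsimp only at hj hy hyi
    subst hj
    let i' : Fin (c n + 1) := ⟨i, by omega⟩
    let x : Digits c := Function.update y n i'
    have hx : x n = i' := Function.update_self ..
    have hn : i' ≠ Fin.last _ := fun h => hi.ne (congrArg Fin.val h)
    have hi1 : i' + 1 = y n := by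
      apply Fin.ext
      rw [Fin.val_add_one_of_lt (Fin.lt_last_iff_ne_last.2 hn), hyi]
    have h1 := iterate_height_add (a := a) (x := x) (n := n) (by rwa [hx])
    rw [hx, hi1, Function.update_idem, Function.update_eq_self, patch_self_of (v := 0) hy] at h1
    refine ⟨(patch 0 n x, 0), ⟨rfl, fun k hk => patch_of_lt hk, ?_⟩, h1⟩
    dsimp only
    rw [patch_of_le le_rfl, hx]

/-- The return time to the base of the tower of stage `n` is at least the height of the tower. -/
theorem iterate_notMem_base {n d : ℕ} (hd : 0 < d) (hd' : d < height c a n) (x : Digits c) :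
    (⇑(cutStack c a))^[d] (patch 0 n x, 0) ∉ base c n := by
  induction n generalizing d x with
  | zero => simp [towerHeight] at hd'; omega
  | succ n ih =>
    -- `l` is the column of stage `n`, and `r` the height in it, that is reached after `d` steps.
    let l := Nat.findGreatest (fun l => pos c a n l ≤ d) (c n)
    have hl : pos c a n l ≤ d :=
      Nat.findGreatest_spec (P := fun l => pos c a n l ≤ d) (Nat.zero_le _)
        ((columnPos_zero n).trans_le (Nat.zero_le _))
    have hlc : l ≤ c n := Nat.findGreatest_le _
    obtain ⟨r, hr⟩ := Nat.exists_eq_add_of_le' hl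
    let i : Fin (c n + 1) := ⟨l, by omega⟩
    let y : Digits c := Function.update x n i
    have hy : y n = i := Function.update_self ..
    have e1 : patch 0 (n + 1) x = patch 0 (n + 1) y :=
      patch_congr fun k hk => (Function.update_of_ne (by omega) _ _).symm
    have e2 := iterate_pos (a := a) n y
    rw [hy] at e2
    rw [hr, Function.iterate_add_apply, e1, e2]
    intro hmem
    rcases Nat.lt_or_ge r (height c a n) with hrh | hrh
    · rcases Nat.eq_zero_or_pos r with rfl | hr0
      · have h0 : y n = 0 := (patch_of_le le_rfl).symm.trans (hmem.2 n (Nat.lt_succ_self n))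
        have : l = 0 := congrArg Fin.val (hy.symm.trans h0)
        rw [this, pos, columnPos_zero] at hr
        omega
      · exact ih hr0 hrh y ⟨hmem.1, fun k hk => hmem.2 k (hk.trans (Nat.lt_succ_self n))⟩
    · have hlt : l < c n := by
        refine lt_of_le_of_ne hlc fun h => ?_
        have h2 := pos_last (c := c) (a := a) n
        rw [h] at hr
        omega
      have hr2 : r < height c a n + a n l := by
        by_contra! h
        have := Nat.findGreatest_is_greatest (P := fun l => pos c a n l ≤ d)
          (Nat.lt_succ_self l) hlt
        have h3 : pos c a n (l + 1) = pos c a n l + (height c a n + a n l) := columnPos_succ n l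
        change ¬ pos c a n (l + 1) ≤ d at this
        omega
      have hn : y n ≠ Fin.last _ := by
        rw [hy]; exact fun h => hlt.ne (congrArg Fin.val h)
      have hpos := height_pos (c := c) (a := a) n
      obtain ⟨j, hj⟩ := Nat.exists_eq_add_of_le' (show height c a n - 1 ≤ r by omega)
      rw [hj, Function.iterate_add_apply, iterate_height_sub_one, cutStack_iterate_of_le] at hmem
      · have : j = 0 := hmem.1
        omega
      · rw [extra_patch_top hn, hy]
        change j ≤ a n l
        omega

theorem disjoint_levels {n k l : ℕ} (hk : k < height c a n) (hl : l < height c a n) (hkl : k ≠ l) :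
    Disjoint ((⇑(cutStack c a))^[k] '' base c n) ((⇑(cutStack c a))^[l] '' base c n) := by
  wlog h : k < l generalizing k l
  · exact (this hl hk hkl.symm (by omega)).symm
  rw [Set.disjoint_left]
  rintro _ ⟨p, hp, rfl⟩ ⟨⟨x, _⟩, ⟨rfl, hx⟩, h'⟩
  obtain ⟨d, rfl⟩ := Nat.exists_eq_add_of_lt h
  rw [add_assoc, Function.iterate_add_apply] at h'
  have := (cutStack c a).injective.iterate k h'
  refine iterate_notMem_base (a := a) (n := n) (d := d + 1) (by omega) (by omega) x ?_
  rwa [patch_self_of (v := 0) hx, this]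

end Digits

/-! ### Approximation by unions of tower levels -/

/-- `B` is approximated in measure by sets taken from the families `𝓕 n`, as `n → ∞`. -/
def Approximable {X : Type*} [MeasurableSpace X] (μ : Measure X) (𝓕 : ℕ → Set (Set X))
    (B : Set X) : Prop :=
  ∀ ε : ENNReal, 0 < ε → ∀ᶠ n in atTop, ∃ L ∈ 𝓕 n, μ (symmDiff B L) < ε

namespace Approximable

variable {X : Type*} [MeasurableSpace X] {μ : Measure X} {𝓕 : ℕ → Set (Set X)}

theorem of_eventually_mem {B : Set X} (h : ∀ᶠ n in atTop, B ∈ 𝓕 n) : Approximable μ 𝓕 B :=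
  fun ε hε => h.mono fun _ hn => ⟨B, hn, by simpa using hε⟩

theorem of_approx {B : Set X}
    (h : ∀ ε : ENNReal, 0 < ε → ∃ B', Approximable μ 𝓕 B' ∧ μ (symmDiff B B') < ε) :
    Approximable μ 𝓕 B := by
  intro ε hε
  obtain ⟨B', hB', hlt⟩ := h (ε / 2) (ENNReal.half_pos hε.ne')
  filter_upwards [hB' (ε / 2) (ENNReal.half_pos hε.ne')] with n ⟨L, hL, hL'⟩
  refine ⟨L, hL, (measure_symmDiff_le _ B' _).trans_lt ?_⟩
  calc _ < ε / 2 + ε / 2 := ENNReal.add_lt_add hlt hL'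
    _ = ε := ENNReal.add_halves ε

theorem sdiff (h𝓕 : ∀ n, ∀ L ∈ 𝓕 n, ∀ L' ∈ 𝓕 n, L \ L' ∈ 𝓕 n) {B B' : Set X}
    (hB : Approximable μ 𝓕 B) (hB' : Approximable μ 𝓕 B') : Approximable μ 𝓕 (B \ B') := by
  intro ε hε
  filter_upwards [hB (ε / 2) (ENNReal.half_pos hε.ne'), hB' (ε / 2) (ENNReal.half_pos hε.ne')]
    with n ⟨L, hL, h⟩ ⟨L', hL', h'⟩
  refine ⟨L \ L', h𝓕 n L hL L' hL', ?_⟩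
  calc μ (symmDiff (B \ B') (L \ L')) ≤ μ (symmDiff B L ∪ symmDiff B' L') := by
        refine measure_mono fun x hx => ?_
        simp only [Set.mem_symmDiff, Set.mem_sdiff, Set.mem_union] at hx ⊢
        tauto
    _ ≤ _ := measure_union_le _ _
    _ < ε / 2 + ε / 2 := ENNReal.add_lt_add h h'
    _ = ε := ENNReal.add_halves ε

theorem union (h𝓕 : ∀ n, ∀ L ∈ 𝓕 n, ∀ L' ∈ 𝓕 n, L ∪ L' ∈ 𝓕 n) {B B' : Set X}
    (hB : Approximable μ 𝓕 B) (hB' : Approximable μ 𝓕 B') : Approximable μ 𝓕 (B ∪ B') := by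
  intro ε hε
  filter_upwards [hB (ε / 2) (ENNReal.half_pos hε.ne'), hB' (ε / 2) (ENNReal.half_pos hε.ne')]
    with n ⟨L, hL, h⟩ ⟨L', hL', h'⟩
  refine ⟨L ∪ L', h𝓕 n L hL L' hL', ?_⟩
  calc μ (symmDiff (B ∪ B') (L ∪ L')) ≤ μ (symmDiff B L ∪ symmDiff B' L') := by
        refine measure_mono fun x hx => ?_
        simp only [Set.mem_symmDiff, Set.mem_union] at hx ⊢
        tauto
    _ ≤ _ := measure_union_le _ _
    _ < ε / 2 + ε / 2 := ENNReal.add_lt_add h h'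
    _ = ε := ENNReal.add_halves ε

theorem iUnion [IsFiniteMeasure μ] (h𝓕 : ∀ n, ∀ L ∈ 𝓕 n, ∀ L' ∈ 𝓕 n, L ∪ L' ∈ 𝓕 n)
    {B : ℕ → Set X} (hm : ∀ i, MeasurableSet (B i)) (hB : ∀ i, Approximable μ 𝓕 (B i)) :
    Approximable μ 𝓕 (⋃ i, B i) := by
  refine of_approx fun ε hε => ?_
  have hacc : ∀ M, Approximable μ 𝓕 (Set.accumulate B M) := by
    intro M
    induction M with
    | zero => simpa [Set.accumulate] using hB 0
    | succ M ih =>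
      rw [Set.accumulate_succ]
      exact ih.union h𝓕 (hB _)
  have hmacc : ∀ M, MeasurableSet (Set.accumulate B M) := fun M =>
    MeasurableSet.biUnion (Set.to_countable _) fun i _ => hm i
  have hlim : Tendsto (fun M => μ ((⋃ i, B i) \ Set.accumulate B M)) atTop (𝓝 0) := by
    have h1 := tendsto_measure_iInter_atTop (μ := μ) (s := fun M => (⋃ i, B i) \ Set.accumulate B M)
      (fun M => ((MeasurableSet.iUnion hm).diff (hmacc M)).nullMeasurableSet)
      (fun M N h => Set.sdiff_subset_sdiff_right (Set.monotone_accumulate h))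
      ⟨0, measure_ne_top _ _⟩
    have h2 : ⋂ M, ((⋃ i, B i) \ Set.accumulate B M) = ∅ := by
      rw [← Set.sdiff_iUnion, Set.iUnion_accumulate, Set.sdiff_self]
    rwa [h2, measure_empty] at h1
  obtain ⟨M, hM⟩ := (hlim.eventually (gt_mem_nhds hε)).exists
  refine ⟨_, hacc M, ?_⟩
  have : Set.accumulate B M ⊆ ⋃ i, B i := by
    rw [← Set.iUnion_accumulate]
    exact Set.subset_iUnion _ M
  rwa [Set.symmDiff_def, Set.sdiff_eq_empty.2 this, Set.union_empty]

end Approximable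

namespace Digits

variable {c : ℕ → ℕ} {a : ℕ → ℕ → ℕ}

/-- The unions of levels of the tower of stage `n`. -/
def levelUnions (c : ℕ → ℕ) (a : ℕ → ℕ → ℕ) (n : ℕ) : Set (Set (Digits c × ℕ)) :=
  {L | ∃ I ⊆ Finset.range (height c a n), L = ⋃ k ∈ I, (⇑(cutStack c a))^[k] '' base c n}

theorem union_mem_levelUnions (n : ℕ) {L L' : Set (Digits c × ℕ)} (hL : L ∈ levelUnions c a n)
    (hL' : L' ∈ levelUnions c a n) : L ∪ L' ∈ levelUnions c a n := by
  classical
  obtain ⟨I, hI, rfl⟩ := hL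
  obtain ⟨I', hI', rfl⟩ := hL'
  exact ⟨I ∪ I', Finset.union_subset hI hI', by rw [Finset.set_biUnion_union]⟩

theorem sdiff_mem_levelUnions (n : ℕ) {L L' : Set (Digits c × ℕ)} (hL : L ∈ levelUnions c a n)
    (hL' : L' ∈ levelUnions c a n) : L \ L' ∈ levelUnions c a n := by
  classical
  obtain ⟨I, hI, rfl⟩ := hL
  obtain ⟨I', hI', rfl⟩ := hL'
  refine ⟨I \ I', Finset.sdiff_subset.trans hI, ?_⟩
  ext p
  simp only [Set.mem_sdiff, Set.mem_iUnion, Finset.mem_sdiff, exists_prop, not_exists, not_and]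
  constructor
  · rintro ⟨⟨k, hk, hp⟩, h⟩
    exact ⟨k, ⟨hk, fun hk' => h k hk' hp⟩, hp⟩
  · rintro ⟨k, ⟨hk, hk'⟩, hp⟩
    refine ⟨⟨k, hk, hp⟩, fun l hl hp' => ?_⟩
    have hne : k ≠ l := fun h => hk' (h ▸ hl)
    exact Set.disjoint_left.1 (disjoint_levels (Finset.mem_range.1 (hI hk))
      (Finset.mem_range.1 (hI' hl)) hne) hp hp'

/-- The ground floor over `t`. -/
def ground (t : Set (Digits c)) : Set (Digits c × ℕ) := {p | p.2 = 0 ∧ p.1 ∈ t}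

theorem ground_cyl (w : Digits c) (n : ℕ) :
    ground (cyl w n) =
      (⇑(cutStack c a))^[∑ k ∈ Finset.range n, pos c a k (w k)] '' base c n := by
  ext ⟨x, j⟩
  constructor
  · rintro ⟨hj, hx⟩
    dsimp only at hj hx
    subst hj
    refine ⟨(patch 0 n x, 0), ⟨rfl, fun k hk => patch_of_lt hk⟩, ?_⟩
    have hs : ∑ k ∈ Finset.range n, pos c a k (w k) = ∑ k ∈ Finset.range n, pos c a k (x k) :=
      Finset.sum_congr rfl fun k hk => by rw [hx k (Finset.mem_range.1 hk)]
    rw [hs]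
    exact iterate_word n x
  · rintro ⟨⟨y, _⟩, ⟨rfl, hy⟩, h⟩
    have h1 := iterate_word (a := a) n (patch w n y)
    have h2 : patch 0 n (patch w n y) = y := by
      funext k
      rcases lt_or_ge k n with hk | hk
      · rw [patch_of_lt hk]
        exact (hy k hk).symm
      · rw [patch_of_le hk, patch_of_le hk]
    have h3 : ∑ k ∈ Finset.range n, pos c a k (patch w n y k) =
        ∑ k ∈ Finset.range n, pos c a k (w k) :=
      Finset.sum_congr rfl fun k hk => by rw [patch_of_lt (Finset.mem_range.1 hk)]
    rw [h2, h3, h] at h1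
    rw [h1]
    exact ⟨rfl, fun k hk => patch_of_lt hk⟩

theorem ground_cyl_mem_levelUnions (w : Digits c) {m n : ℕ} (h : m ≤ n) :
    ground (cyl w m) ∈ levelUnions c a n := by
  classical
  let extend : (∀ k : Fin n, Fin (c k + 1)) → Digits c := fun u k =>
    if h : k < n then u ⟨k, h⟩ else 0
  let U : Finset (∀ k : Fin n, Fin (c k + 1)) := Finset.univ.filter fun u => extend u ∈ cyl w m
  let p : (∀ k : Fin n, Fin (c k + 1)) → ℕ := fun u => ∑ k ∈ Finset.range n, pos c a k (extend u k)
  refine ⟨U.image p, ?_, ?_⟩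
  · intro i hi
    obtain ⟨u, -, rfl⟩ := Finset.mem_image.1 hi
    exact Finset.mem_range.2 (sum_pos_lt n _)
  · rw [Finset.set_biUnion_finset_image]
    simp only [p, ← ground_cyl]
    ext ⟨x, j⟩
    simp only [ground, Set.mem_iUnion, Set.mem_ofPred_eq, exists_prop, U, Finset.mem_filter,
      Finset.mem_univ, true_and]
    constructor
    · rintro ⟨hj, hx⟩
      have hxe : ∀ k < n, x k = extend (fun k => x k) k := fun k hk => by
        change x k = dite _ _ _; rw [dif_pos hk]
      exact ⟨fun k => x k, fun k hk => by rw [← hxe k (hk.trans_le h), hx k hk], hj, hxe⟩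
    · rintro ⟨u, hu, hj, hx⟩
      exact ⟨hj, fun k hk => by rw [hx k (hk.trans_le h), hu k hk]⟩

/-- Moving a union of levels up by one step yields a union of levels again, except for the top
level, whose measure tends to zero. -/
theorem approximable_image {μ : Measure (Digits c × ℕ)}
    (hT : MeasurePreserving (cutStack c a) μ μ)
    (hbase : Tendsto (fun n => μ (base c n)) atTop (𝓝 0)) {B : Set (Digits c × ℕ)}
    (hB : Approximable μ (levelUnions c a) B) :
    Approximable μ (levelUnions c a) (cutStack c a '' B) := by
  intro ε hε
  filter_upwards [hB (ε / 2) (ENNReal.half_pos hε.ne'),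
    hbase.eventually (gt_mem_nhds (ENNReal.half_pos hε.ne'))] with n ⟨L, ⟨I, hI, hL⟩, h⟩ hn
  refine ⟨_, ⟨(I.image (· + 1)).filter (· < height c a n), fun k hk =>
    Finset.mem_range.2 (Finset.mem_filter.1 hk).2, rfl⟩, ?_⟩
  calc μ (symmDiff _ _) ≤ μ (cutStack c a '' (symmDiff B L) ∪
        (⇑(cutStack c a))^[height c a n] '' base c n) := by
        refine measure_mono ?_
        have himg : cutStack c a '' L = ⋃ k ∈ I, (⇑(cutStack c a))^[k + 1] '' base c n := by
          rw [hL, Set.image_iUnion₂]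
          simp only [Function.iterate_succ', Set.image_comp]
        rw [Set.image_symmDiff (cutStack c a).injective, himg]
        intro p hp
        simp only [Set.mem_symmDiff, Set.mem_union, Set.mem_iUnion, Finset.mem_filter,
          Finset.mem_image, exists_prop] at hp ⊢
        rcases hp with ⟨hp1, hp2⟩ | ⟨⟨k, ⟨⟨k', hk', rfl⟩, hk2⟩, hpk⟩, hp2⟩
        · by_cases hp3 : ∃ i ∈ I, p ∈ (⇑(cutStack c a))^[i + 1] '' base c n
          · obtain ⟨i, hi, hpi⟩ := hp3
            right
            have h1 : i < height c a n := Finset.mem_range.1 (hI hi)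
            have h2 : ¬ i + 1 < height c a n := fun h2 => hp2 ⟨i + 1, ⟨⟨i, hi, rfl⟩, h2⟩, hpi⟩
            rwa [show height c a n = i + 1 by omega]
          · exact Or.inl (Or.inl ⟨hp1, hp3⟩)
        · exact Or.inl (Or.inr ⟨⟨k', hk', hpk⟩, hp2⟩)
    _ ≤ μ (cutStack c a '' (symmDiff B L)) + μ ((⇑(cutStack c a))^[height c a n] '' base c n) :=
        measure_union_le _ _
    _ = μ (symmDiff B L) + μ (base c n) := by
        rw [measure_iterate_image hT _ (measurableSet_base n)]
        congr 1
        have := hT.measure_preimage_equiv (cutStack c a '' symmDiff B L)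
        rwa [Set.preimage_image_eq _ (cutStack c a).injective, eq_comm] at this
    _ < ε / 2 + ε / 2 := ENNReal.add_lt_add h hn
    _ = ε := ENNReal.add_halves ε

theorem measurableSet_ground {t : Set (Digits c)} (ht : MeasurableSet t) :
    MeasurableSet (ground t) := measurableSet_prod_zero ht

theorem approximable_ground {μ : Measure (Digits c × ℕ)} [IsFiniteMeasure μ] (t : Set (Digits c))
    (ht : MeasurableSet t) : Approximable μ (levelUnions c a) (ground t) := by
  have huniv : Approximable μ (levelUnions c a) (ground Set.univ) := by
    refine .of_eventually_mem (.of_forall fun n => ?_)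
    have := ground_cyl_mem_levelUnions (a := a) (0 : Digits c) (Nat.zero_le n)
    simpa [cyl] using this
  induction t, ht using MeasurableSpace.induction_on_inter generateFrom_cyl isPiSystem_cyl with
  | empty =>
    refine .of_eventually_mem (.of_forall fun n => ⟨∅, by simp, by simp [ground]⟩)
  | basic t ht =>
    obtain ⟨w, m, rfl⟩ := ht
    exact .of_eventually_mem ((eventually_ge_atTop m).mono fun n hn =>
      ground_cyl_mem_levelUnions w hn)
  | compl t _ ih =>
    have : ground tᶜ = ground (c := c) Set.univ \ ground t := by
      ext p; simp only [ground, Set.mem_ofPred_eq, Set.mem_compl_iff, Set.mem_sdiff, Set.mem_univ]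
      tauto
    rw [this]
    exact huniv.sdiff (fun n L hL L' hL' => sdiff_mem_levelUnions n hL hL') ih
  | iUnion f _ hf ih =>
    have : ground (⋃ i, f i) = ⋃ i, ground (f i) := by
      ext p; simp [ground]
    rw [this]
    exact .iUnion (fun n L hL L' hL' => union_mem_levelUnions n hL hL')
      (fun i => measurableSet_ground (hf i)) ih

theorem iterate_image_ground {t : Set (Digits c)} {j : ℕ} (ht : ∀ x ∈ t, j ≤ extra a x) :
    (⇑(cutStack c a))^[j] '' ground t = {p | p.2 = j ∧ p.1 ∈ t} := by
  ext ⟨x, i⟩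
  constructor
  · rintro ⟨⟨y, _⟩, ⟨rfl, hy⟩, h⟩
    rw [cutStack_iterate_of_le (ht y hy)] at h
    cases h
    exact ⟨rfl, hy⟩
  · rintro ⟨hi, hx⟩
    dsimp only at hi hx
    subst hi
    exact ⟨(x, 0), ⟨rfl, hx⟩, cutStack_iterate_of_le (ht x hx)⟩

/-- Up to a null set, `B` is the union of its intersections with the floors, and the intersection
with the `j`-th floor is the image under the `j`-th iterate of a part of the ground floor. -/
theorem approximable {μ : Measure (Digits c × ℕ)} [IsFiniteMeasure μ]
    (hT : MeasurePreserving (cutStack c a) μ μ)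
    (hbase : Tendsto (fun n => μ (base c n)) atTop (𝓝 0))
    (hfloor : μ {p | extra a p.1 < p.2} = 0) {B : Set (Digits c × ℕ)} (hB : MeasurableSet B) :
    Approximable μ (levelUnions c a) B := by
  let t : ℕ → Set (Digits c) := fun j => {x | (x, j) ∈ B ∧ j ≤ extra a x}
  have ht : ∀ j, MeasurableSet (t j) := fun j =>
    ((measurable_id.prodMk measurable_const) hB).inter
      (measurableSet_le measurable_const measurable_extra)
  have hiter : ∀ j i, Approximable μ (levelUnions c a) ((⇑(cutStack c a))^[i] '' ground (t j)) := by
    intro j i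
    induction i with
    | zero => simpa using approximable_ground _ (ht j)
    | succ i ih =>
      rw [Function.iterate_succ', Set.image_comp]
      exact approximable_image hT hbase ih
  refine .of_approx fun ε hε => ⟨_, .iUnion (fun n L hL L' hL' => union_mem_levelUnions n hL hL')
    (fun j => measurableSet_iterate_image _ j (measurableSet_ground (ht j)))
    (fun j => hiter j j), ?_⟩
  refine (measure_mono_null ?_ hfloor).trans_lt hε
  rintro ⟨x, j⟩ hx
  simp only [iterate_image_ground fun x (hx : x ∈ t _) => hx.2, Set.mem_symmDiff, Set.mem_iUnion,
    Set.mem_ofPred_eq] at hx ⊢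
  by_contra! hj
  rcases hx with ⟨hx, h⟩ | ⟨⟨i, rfl, h⟩, hx⟩
  · exact h ⟨j, rfl, hx, hj⟩
  · exact hx h.1

/-- The number of columns of the tower of stage `n` into which the ground floor is cut. -/
def columnCount (c : ℕ → ℕ) (n : ℕ) : ℕ := ∏ k ∈ Finset.range n, (c k + 1)

theorem columnCount_pos (n : ℕ) : 0 < columnCount c n :=
  Finset.prod_pos fun _ _ => Nat.succ_pos _

/-- The ratio of height and number of columns is the measure of the tower of stage `N` when the
ground floor has measure `1`; the spacers of stage `n` contribute the `n`-th term of the sum. -/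
theorem sum_spacerCount_div (N : ℕ) :
    1 + ∑ n ∈ Finset.range N,
        (spacerCount (fun n => c n + 1) a n : ℝ) / (columnCount c (n + 1) : ℝ) =
      (height c a N : ℝ) / columnCount c N := by
  induction N with
  | zero => simp [towerHeight, columnCount]
  | succ N ih =>
    have h1 : (columnCount c N : ℝ) ≠ 0 := by exact_mod_cast (columnCount_pos N).ne'
    have h2 : (columnCount c (N + 1) : ℝ) = columnCount c N * (c N + 1) := by
      simp [columnCount, Finset.prod_range_succ]
    have h3 : ((c N : ℝ) + 1) ≠ 0 := by positivity
    rw [Finset.sum_range_succ, ← add_assoc, ih, h2]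
    simp only [height, towerHeight]
    push_cast
    field_simp

theorem summable_spacerCount {B : ℕ} (hB : ∀ n, height c a n ≤ B * columnCount c n) :
    Summable fun n => (spacerCount (fun n => c n + 1) a n : ℝ) / (columnCount c (n + 1) : ℝ) := by
  refine summable_of_sum_range_le (c := B) (fun n => by positivity) fun N => ?_
  have h1 := sum_spacerCount_div (c := c) (a := a) N
  have h2 : (height c a N : ℝ) / columnCount c N ≤ B := by
    rw [div_le_iff₀ (by exact_mod_cast columnCount_pos N)]
    exact_mod_cast hB N
  linarith

theorem columnCount_le_height (n : ℕ) : columnCount c n ≤ height c a n := by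
  induction n with
  | zero => simp [columnCount, towerHeight]
  | succ n ih =>
    rw [columnCount, Finset.prod_range_succ]
    change columnCount c n * _ ≤ (c n + 1) * height c a n + _
    nlinarith

/-- The spacers of stage `n` lie above the cylinders of sequences that start with `n` largest digits
followed by a digit that is not the largest one. -/
theorem measure_floors_le :
    Skyscraper.floorMeasure (unif c) (extra a) Set.univ ≤ 1 + ∑' n,
      (spacerCount (fun n => c n + 1) a n : ENNReal) * (columnCount c (n + 1) : ENNReal)⁻¹ := by
  rw [Skyscraper.floorMeasure_apply _ MeasurableSet.univ, tsum_eq_zero_add' ENNReal.summable]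
  refine add_le_add prob_le_one ?_
  calc ∑' j, unif c {x | (x, j + 1) ∈ Set.univ ∧ j + 1 ≤ extra a x}
      ≤ ∑' j, ∑' n, ∑ i ∈ Finset.range (c n),
          if j < a n i then (columnCount c (n + 1) : ENNReal)⁻¹ else 0 := by
        refine ENNReal.tsum_le_tsum fun j => ?_
        let w : ℕ → ℕ → Digits c := fun n i =>
          Function.update top n (Fin.ofNat (c n + 1) i)
        calc _ ≤ unif c (⋃ n, ⋃ i ∈ Finset.range (c n),
              if j < a n i then cyl (w n i) (n + 1) else ∅) := by
              refine measure_mono fun x hx => ?_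
              obtain ⟨n, hn, hn'⟩ := exists_first_of_extra_pos
                ((Nat.succ_pos j).trans_le hx.2)
              have hx2 := hx.2
              rw [extra_eq hn hn'] at hx2
              have hlt : (x n : ℕ) < c n := by
                have := Fin.lt_last_iff_ne_last.2 hn'
                exact this
              refine Set.mem_iUnion.2 ⟨n, Set.mem_iUnion₂.2 ⟨x n, Finset.mem_range.2 hlt, ?_⟩⟩
              rw [if_pos (Nat.lt_of_succ_le hx2)]
              intro k hk
              rcases Nat.lt_succ_iff_lt_or_eq.1 hk with hk | rfl
              · rw [hn k hk]
                change Fin.last (c k) = Function.update top n _ k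
                rw [Function.update_of_ne hk.ne]
                rfl
              · simp only [w, Function.update_self]
                exact (Fin.ofNat_val_eq_self _).symm
          _ ≤ ∑' n, unif c (⋃ i ∈ Finset.range (c n),
              if j < a n i then cyl (w n i) (n + 1) else ∅) := measure_iUnion_le _
          _ ≤ _ := by
              refine ENNReal.tsum_le_tsum fun n => (measure_biUnion_finset_le _ _).trans
                (Finset.sum_le_sum fun i _ => ?_)
              split_ifs
              · rw [unif_cyl, columnCount, Nat.cast_prod]
              · simp
    _ = ∑' n, ∑ i ∈ Finset.range (c n), ∑' j,
          if j < a n i then (columnCount c (n + 1) : ENNReal)⁻¹ else 0 := by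
        rw [ENNReal.tsum_comm]
        exact tsum_congr fun n => Summable.tsum_finsetSum fun _ _ => ENNReal.summable
    _ = _ := by
        refine tsum_congr fun n => ?_
        rw [spacerCount, Nat.cast_sum, Finset.sum_mul]
        refine Finset.sum_congr rfl fun i _ => ?_
        rw [tsum_eq_sum (s := Finset.range (a n i)) fun j hj => if_neg (by simpa using hj),
          Finset.sum_congr rfl fun j hj => if_pos (Finset.mem_range.1 hj)]
        simp

theorem tendsto_measure_base {μ : Measure (Digits c × ℕ)} [IsFiniteMeasure μ]
    (hT : MeasurePreserving (cutStack c a) μ μ) (hc : ∃ᶠ n in atTop, 2 ≤ c n + 1) :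
    Tendsto (fun n => μ (base c n)) atTop (𝓝 0) := by
  have h1 : Tendsto (fun n => μ Set.univ * (height c a n : ENNReal)⁻¹) atTop (𝓝 0) := by
    have := ENNReal.Tendsto.const_mul (a := μ Set.univ)
      (ENNReal.tendsto_inv_nat_nhds_zero.comp
        (tendsto_towerHeight (a := a) (fun n => Nat.succ_pos (c n)) hc))
      (Or.inr (measure_ne_top _ _))
    simpa using this
  refine tendsto_of_tendsto_of_tendsto_of_le_of_le tendsto_const_nhds h1 (fun _ => bot_le)
    fun n => ?_
  have hpos := height_pos (c := c) (a := a) n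
  change _ ≤ μ Set.univ * _
  rw [← div_eq_mul_inv, ENNReal.le_div_iff_mul_le (Or.inl (by exact_mod_cast hpos.ne'))
    (Or.inl (ENNReal.natCast_ne_top _))]
  calc μ (base c n) * height c a n
      = ∑ k ∈ Finset.range (height c a n), μ ((⇑(cutStack c a))^[k] '' base c n) := by
        simp [measure_iterate_image hT _ (measurableSet_base n), mul_comm]
    _ = μ (⋃ k ∈ Finset.range (height c a n), (⇑(cutStack c a))^[k] '' base c n) := by
        refine (measure_biUnion_finset (fun k hk l hl hkl => ?_) fun k _ =>
          measurableSet_iterate_image _ k (measurableSet_base n)).symm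
        exact disjoint_levels (Finset.mem_range.1 hk) (Finset.mem_range.1 hl) hkl
    _ ≤ μ Set.univ := measure_mono (Set.subset_univ _)

end Digits

/-- Any cutting and stacking data for which the expected height of the skyscraper over the odometer
is finite are realised by a rank one system. -/
theorem exists_isCutAndStack {q : ℕ → ℕ} {a : ℕ → ℕ → ℕ} (hq : ∀ n, 1 ≤ q n)
    (hfreq : ∃ᶠ n in atTop, 2 ≤ q n) {B : ℕ}
    (hB : ∀ n, towerHeight q a n ≤ B * ∏ k ∈ Finset.range n, q k) :
    ∃ (X : Type) (_ : MeasurableSpace X) (_ : StandardBorelSpace X) (μ : Measure X)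
      (_ : IsProbabilityMeasure μ) (T : X ≃ᵐ X), MeasurePreserving T μ μ ∧
      ∃ (F : ℕ → Set X) (E : ℕ → ℕ → Set X) (C : ℕ → ℕ → ℕ → Set X),
        IsCutAndStack μ T q a F E C := by
  obtain ⟨c, rfl⟩ : ∃ c : ℕ → ℕ, q = fun n => c n + 1 :=
    ⟨fun n => q n - 1, funext fun n => (Nat.sub_add_cancel (hq n)).symm⟩
  have hsum := Digits.summable_spacerCount (c := c) (a := a) hB
  let ν := Skyscraper.floorMeasure (Digits.unif c) (Digits.extra a)
  have hνfin : ν Set.univ ≠ ⊤ := by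
    refine ne_top_of_le_ne_top ?_ Digits.measure_floors_le
    refine ENNReal.add_ne_top.2 ⟨ENNReal.one_ne_top, ?_⟩
    convert hsum.tsum_ofReal_ne_top using 4 with n
    rw [ENNReal.ofReal_div_of_pos (by exact_mod_cast Digits.columnCount_pos _),
      ENNReal.ofReal_natCast, ENNReal.ofReal_natCast, div_eq_mul_inv]
  have hνpos : ν Set.univ ≠ 0 := by
    have h1 : (1 : ENNReal) ≤ ν Set.univ := by
      change 1 ≤ Skyscraper.floorMeasure _ _ _
      rw [Skyscraper.floorMeasure_apply _ MeasurableSet.univ]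
      refine le_trans ?_ (ENNReal.le_tsum 0)
      simp
    exact (zero_lt_one.trans_le h1).ne'
  let μ := (ν Set.univ)⁻¹ • ν
  have hμ : IsProbabilityMeasure μ := ⟨by
    change (ν Set.univ)⁻¹ * ν Set.univ = 1
    exact ENNReal.inv_mul_cancel hνpos hνfin⟩
  have hT : MeasurePreserving (Digits.cutStack c a) μ μ :=
    (Skyscraper.floorMeasure_preserving Digits.measurable_extra
      Digits.measurePreserving_odometer).smul_measure _
  have hfloor : μ {p | Digits.extra a p.1 < p.2} = 0 := by
    have hm : MeasurableSet {p : Digits c × ℕ | Digits.extra a p.1 < p.2} :=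
      measurableSet_lt (Digits.measurable_extra.comp measurable_fst) measurable_snd
    change (ν Set.univ)⁻¹ * Skyscraper.floorMeasure _ _ _ = 0
    rw [Skyscraper.floorMeasure_apply _ hm, ENNReal.tsum_eq_zero.2, mul_zero]
    intro j
    convert measure_empty (μ := Digits.unif c)
    ext x
    simp only [Set.mem_ofPred_eq, Set.mem_empty_iff_false, iff_false, not_and, not_le]
    exact id
  refine ⟨Digits c × ℕ, inferInstance, inferInstance, μ, hμ, Digits.cutStack c a, hT,
    Digits.base c, Digits.columnBase c,
    fun n i j => (⇑(Digits.cutStack c a))^[Digits.height c a n + j] '' Digits.columnBase c n i, ?_⟩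
  exact
    { q_pos := hq
      q_frequently := hfreq
      summable := by
        refine hsum.of_nonneg_of_le (fun n => by positivity) fun n => ?_
        gcongr
        · exact_mod_cast Digits.columnCount_pos _
        · exact Digits.columnCount_le_height _
      measurableSet_base := Digits.measurableSet_base
      measurableSet_sub := fun n i _ => Digits.measurableSet_columnBase n i
      measurableSet_spacer := fun n i _ j _ =>
        measurableSet_iterate_image _ _ (Digits.measurableSet_columnBase n i)
      disjoint_levels := fun n k hk l hl hkl => Digits.disjoint_levels hk hl hkl
      disjoint_sub := fun n i _ j _ hij =>
        Set.disjoint_left.2 fun p hp hp' => hij (hp.2.2.symm.trans hp'.2.2)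
      union_sub := fun n => by
        ext p
        simp only [Set.mem_iUnion, Finset.mem_range, exists_prop]
        constructor
        · rintro ⟨i, -, hp⟩
          exact ⟨hp.1, hp.2.1⟩
        · rintro hp
          exact ⟨p.1 n, (p.1 n).isLt, hp.1, hp.2, rfl⟩
      top_to_spacer := fun n i _ _ => rfl
      top_to_sub := fun n i hi h0 => by
        have := Digits.image_columnBase (a := a) (n := n) (i := i) hi
        rwa [h0] at this
      spacer_to_spacer := fun n i _ j _ => by
        rw [← add_assoc, Function.iterate_succ', Set.image_comp]
      spacer_to_sub := fun n i hi j hj => by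
        have := Digits.image_columnBase (a := a) (n := n) (i := i) hi
        rwa [← hj, ← add_assoc, Function.iterate_succ', Set.image_comp] at this
      base_succ := fun n => by
        ext p
        simp only [Digits.base, Digits.columnBase, Set.mem_ofPred_eq, Nat.forall_lt_succ_right,
          Fin.ext_iff (a := p.1 n), Fin.val_zero]
      approximates := fun D hD ε hε => by
        have h := Digits.approximable hT (Digits.tendsto_measure_base hT hfreq) hfloor hD
          (ENNReal.ofReal ε) (ENNReal.ofReal_pos.2 hε)
        obtain ⟨N, hN⟩ := eventually_atTop.1 h
        refine ⟨N, fun n hn => ?_⟩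
        obtain ⟨_, ⟨I, hI, rfl⟩, hlt⟩ := hN n hn
        refine ⟨I, hI, ?_⟩
        rw [Measure.real, ← ENNReal.toReal_ofReal hε.le]
        exact (ENNReal.toReal_lt_toReal (measure_ne_top _ _) ENNReal.ofReal_ne_top).2 hlt }

/-! ### Towers of a cutting and stacking construction -/

namespace IsCutAndStack

variable {X : Type*} [MeasurableSpace X] {μ : Measure X} {T : X ≃ᵐ X} {q : ℕ → ℕ}
  {a : ℕ → ℕ → ℕ} {F : ℕ → Set X} {E : ℕ → ℕ → Set X} {C : ℕ → ℕ → ℕ → Set X}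

theorem image_sub (H : IsCutAndStack μ T q a F E C) {n i : ℕ} (hi : i < q n - 1) :
    (⇑T)^[towerHeight q a n + a n i] '' E n i = E n (i + 1) := by
  rcases Nat.eq_zero_or_pos (a n i) with h0 | h0
  · rw [h0, add_zero]
    exact H.top_to_sub n i hi h0
  · have hC : ∀ j, j < a n i → (⇑T)^[towerHeight q a n + j] '' E n i = C n i j := by
      intro j
      induction j with
      | zero => exact fun _ => H.top_to_spacer n i hi h0
      | succ j ih =>
        intro hj
        rw [← add_assoc, Function.iterate_succ', Set.image_comp, ih (by omega),
          H.spacer_to_spacer n i hi j hj]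
    obtain ⟨j, hj⟩ : ∃ j, j + 1 = a n i := ⟨a n i - 1, by omega⟩
    rw [← hj, ← add_assoc, Function.iterate_succ', Set.image_comp, hC j (by omega),
      H.spacer_to_sub n i hi j hj]

/-- The base of the `l`-th column of stage `n` is a level of the tower of stage `n + 1`. -/
theorem sub_eq (H : IsCutAndStack μ T q a F E C) {n l : ℕ} (hl : l < q n) :
    E n l = (⇑T)^[columnPos q a n l] '' F (n + 1) := by
  induction l with
  | zero => simp [columnPos_zero, H.base_succ]
  | succ l ih =>
    rw [← H.image_sub (by omega), ih (by omega), iterate_image_iterate_image, columnPos_succ,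
      add_comm]

theorem base_eq (H : IsCutAndStack μ T q a F E C) (n : ℕ) :
    F n = ⋃ l ∈ Finset.range (q n), (⇑T)^[columnPos q a n l] '' F (n + 1) := by
  rw [← H.union_sub]
  exact Set.iUnion₂_congr fun l hl => H.sub_eq (Finset.mem_range.1 hl)

/-- The base of a tower is a union of levels of each later tower, and the whole columns above these
levels belong to the later tower. -/
theorem exists_base_eq (H : IsCutAndStack μ T q a F E C) {m n : ℕ} (hmn : m ≤ n) :
    ∃ V : Finset ℕ, (∀ v ∈ V, v + towerHeight q a m ≤ towerHeight q a n) ∧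
      F m = ⋃ v ∈ V, (⇑T)^[v] '' F n := by
  induction n, hmn using Nat.le_induction with
  | base => exact ⟨{0}, by simp, by simp⟩
  | succ n _ ih =>
    obtain ⟨V, hV, hF⟩ := ih
    refine ⟨(V ×ˢ Finset.range (q n)).image fun p => p.1 + columnPos q a n p.2, ?_, ?_⟩
    · intro v hv
      obtain ⟨⟨u, l⟩, hul, rfl⟩ := Finset.mem_image.1 hv
      rw [Finset.mem_product, Finset.mem_range] at hul
      have h1 := hV u hul.1
      have h2 := columnPos_mono (q := q) (a := a) n (Nat.le_sub_one_of_lt hul.2)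
      have h3 := columnPos_last (a := a) (H.q_pos n)
      dsimp only at h2 ⊢
      omega
    · rw [hF, H.base_eq n]
      ext x
      simp only [Set.image_iUnion, iterate_image_iterate_image, Set.mem_iUnion, Finset.mem_image,
        Finset.mem_product, Finset.mem_range, exists_prop, Prod.exists]
      constructor
      · rintro ⟨u, hu, l, hl, hx⟩
        exact ⟨_, ⟨u, l, ⟨hu, hl⟩, rfl⟩, hx⟩
      · rintro ⟨_, ⟨u, l, ⟨hu, hl⟩, rfl⟩, hx⟩
        exact ⟨u, hu, l, hl, hx⟩

theorem measurableSet_level (H : IsCutAndStack μ T q a F E C) (n k : ℕ) :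
    MeasurableSet ((⇑T)^[k] '' F n) :=
  measurableSet_iterate_image T k (H.measurableSet_base n)

theorem measureReal_level (H : IsCutAndStack μ T q a F E C) (hT : MeasurePreserving T μ μ)
    (n k : ℕ) : μ.real ((⇑T)^[k] '' F n) = μ.real (F n) := by
  rw [Measure.real, measure_iterate_image hT k (H.measurableSet_base n), Measure.real]

theorem measureReal_biUnion_level (H : IsCutAndStack μ T q a F E C) [IsFiniteMeasure μ]
    (hT : MeasurePreserving T μ μ) {n : ℕ} {I : Finset ℕ}
    (hI : ∀ k ∈ I, k < towerHeight q a n) :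
    μ.real (⋃ k ∈ I, (⇑T)^[k] '' F n) = I.card * μ.real (F n) := by
  rw [measureReal_biUnion_finset]
  · simp [H.measureReal_level hT]
  · exact fun k hk l hl hkl => H.disjoint_levels n k (hI k hk) l (hI l hl) hkl
  · exact fun k _ => H.measurableSet_level n k

variable (T q a F) in
/-- The tower of stage `n`. -/
def tower (n : ℕ) : Set X := ⋃ k ∈ Finset.range (towerHeight q a n), (⇑T)^[k] '' F n

theorem measurableSet_tower (H : IsCutAndStack μ T q a F E C) (n : ℕ) :
    MeasurableSet (tower T q a F n) :=
  Finset.measurableSet_biUnion _ fun k _ => H.measurableSet_level n k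

theorem measureReal_tower (H : IsCutAndStack μ T q a F E C) [IsFiniteMeasure μ]
    (hT : MeasurePreserving T μ μ) (n : ℕ) :
    μ.real (tower T q a F n) = towerHeight q a n * μ.real (F n) := by
  rw [tower, H.measureReal_biUnion_level hT fun k hk => Finset.mem_range.1 hk, Finset.card_range]

/-- The towers fill out the space, since they contain approximations of the whole space. -/
theorem eventually_lt_measureReal_tower (H : IsCutAndStack μ T q a F E C)
    [IsProbabilityMeasure μ] {r : ℝ} (hr : r < 1) :
    ∀ᶠ n in atTop, r < μ.real (tower T q a F n) := by
  obtain ⟨N, hN⟩ := H.approximates Set.univ MeasurableSet.univ (1 - r) (by linarith)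
  filter_upwards [eventually_ge_atTop N] with n hn
  obtain ⟨I, hI, h⟩ := hN n hn
  have h1 : μ.real (⋃ k ∈ I, (⇑T)^[k] '' F n) ≤ μ.real (tower T q a F n) :=
    measureReal_mono (Set.biUnion_subset_biUnion_left hI)
  have h2 : μ.real (⋃ k ∈ I, (⇑T)^[k] '' F n)ᶜ = 1 - μ.real (⋃ k ∈ I, (⇑T)^[k] '' F n) :=
    probReal_compl_eq_one_sub (Finset.measurableSet_biUnion _ fun k _ => H.measurableSet_level n k)
  rw [← Set.top_eq_univ, top_symmDiff, hnot_eq_compl] at h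
  linarith

theorem tower_mono (H : IsCutAndStack μ T q a F E C) {m n : ℕ} (hmn : m ≤ n) :
    tower T q a F m ⊆ tower T q a F n := by
  obtain ⟨V, hV, hF⟩ := H.exists_base_eq hmn
  refine Set.iUnion₂_subset fun k hk => ?_
  rw [hF, Set.image_iUnion₂]
  refine Set.iUnion₂_subset fun v hv => ?_
  rw [iterate_image_iterate_image]
  have h1 := hV v hv
  have h2 := Finset.mem_range.1 hk
  exact Set.subset_biUnion_of_mem (u := fun k => (⇑T)^[k] '' F n)
    (Finset.mem_coe.2 (Finset.mem_range.2 (by omega : k + v < towerHeight q a n)))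

open scoped Classical in
/-- The partition into the levels of the tower of stage `m` and the complement of that tower. -/
def levelPartition (H : IsCutAndStack μ T q a F E C) (m : ℕ) :
    MeasurablePartition (Fin (towerHeight q a m + 1)) X where
  cell i := if (i : ℕ) < towerHeight q a m then (⇑T)^[i] '' F m else (tower T q a F m)ᶜ
  measurableSet_cell i := by
    split_ifs
    · exact H.measurableSet_level m i
    · exact (H.measurableSet_tower m).compl
  disjoint_cell i j hij := by
    have hsub : ∀ k < towerHeight q a m, (⇑T)^[k] '' F m ⊆ tower T q a F m := fun k hk =>
      Set.subset_biUnion_of_mem (u := fun k => (⇑T)^[k] '' F m)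
        (Finset.mem_coe.2 (Finset.mem_range.2 hk))
    have hne : (i : ℕ) ≠ j := fun h => hij (Fin.ext h)
    dsimp only
    split_ifs with hi hj hj
    · exact H.disjoint_levels m i hi j hj hne
    · exact disjoint_compl_right.mono_left (hsub _ hi)
    · exact disjoint_compl_left.mono_right (hsub _ hj)
    · omega
  iUnion_cell := by
    refine Set.eq_univ_of_forall fun x => Set.mem_iUnion.2 ?_
    by_cases hx : x ∈ tower T q a F m
    · obtain ⟨k, hk, hx⟩ := Set.mem_iUnion₂.1 hx
      have hk' := Finset.mem_range.1 hk
      exact ⟨⟨k, by omega⟩, by simpa [hk'] using hx⟩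
    · exact ⟨Fin.last _, by simpa using hx⟩

end IsCutAndStack

/-! ### A lower bound for the entropy -/

/-- Conditioning does not increase entropy, and the entropy of a partition whose cells `w` have
conditional measure at most `exp (-M s w)` given `Z s` is at least the mean value of `M s w`. -/
theorem MeasurablePartition.sum_le_entropy {X κ σ : Type*} [MeasurableSpace X] [Fintype κ]
    {μ : Measure X} [IsProbabilityMeasure μ] (ξ : MeasurablePartition κ X) {S : Finset σ}
    {Z : σ → Set X} (hZ : ∀ s ∈ S, MeasurableSet (Z s))
    (hdisj : (S : Set σ).PairwiseDisjoint Z) (M : σ → κ → ℝ)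
    (hM : ∀ s ∈ S, ∀ w, μ.real (ξ.cell w ∩ Z s) ≤ Real.exp (-M s w) * μ.real (Z s)) :
    ∑ s ∈ S, ∑ w, μ.real (ξ.cell w ∩ Z s) * M s w ≤ ξ.entropy μ := by
  rw [Finset.sum_comm, MeasurablePartition.entropy]
  refine Finset.sum_le_sum fun w _ => ?_
  let U : Set X := ⋃ s ∈ S, Z s
  have hU : MeasurableSet U := Finset.measurableSet_biUnion _ hZ
  have hle : ∀ B B' : Set X, μ.real (B ∩ B') / μ.real B' ≤ 1 := fun B B' =>
    div_le_one_of_le₀ (measureReal_mono Set.inter_subset_right) measureReal_nonneg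
  have hmul : ∀ B B' : Set X, μ.real B' * (μ.real (B ∩ B') / μ.real B') = μ.real (B ∩ B') := by
    intro B B'
    rcases eq_or_ne (μ.real B') 0 with h0 | h0
    · rw [h0, zero_mul]
      exact (le_antisymm ((measureReal_mono Set.inter_subset_right).trans_eq h0)
        measureReal_nonneg).symm
    · exact mul_div_cancel₀ _ h0
  have hsumZ : μ.real Uᶜ + ∑ s ∈ S, μ.real (Z s) = 1 := by
    rw [← measureReal_biUnion_finset hdisj hZ, add_comm]
    exact measureReal_add_measureReal_compl hU |>.trans (by simp)
  have hsum : μ.real (ξ.cell w ∩ Uᶜ) + ∑ s ∈ S, μ.real (ξ.cell w ∩ Z s) = μ.real (ξ.cell w) := by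
    rw [← measureReal_biUnion_finset, ← Set.inter_iUnion₂, add_comm, ← Set.sdiff_eq]
    · exact measureReal_inter_add_sdiff hU
    · exact fun s hs t ht hst => (hdisj hs ht hst).mono Set.inter_subset_right
        Set.inter_subset_right
    · exact fun s hs => (ξ.measurableSet_cell w).inter (hZ s hs)
  have hJ := ConcaveOn.map_add_sum_le Real.concaveOn_negMulLog (t := S) (v := μ.real Uᶜ)
    (w := fun s => μ.real (Z s)) (p := fun s => μ.real (ξ.cell w ∩ Z s) / μ.real (Z s))
    (q := μ.real (ξ.cell w ∩ Uᶜ) / μ.real Uᶜ) (fun _ _ => measureReal_nonneg) hsumZ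
    (fun _ _ => div_nonneg measureReal_nonneg measureReal_nonneg) measureReal_nonneg
    (div_nonneg measureReal_nonneg measureReal_nonneg)
  simp only [smul_eq_mul, hmul, hsum] at hJ
  refine le_trans ?_ hJ
  have h0 : 0 ≤ μ.real Uᶜ * Real.negMulLog (μ.real (ξ.cell w ∩ Uᶜ) / μ.real Uᶜ) :=
    mul_nonneg measureReal_nonneg
      (Real.negMulLog_nonneg (div_nonneg measureReal_nonneg measureReal_nonneg) (hle _ _))
  refine le_add_of_nonneg_of_le h0 (Finset.sum_le_sum fun s hs => ?_)
  rw [Real.negMulLog, neg_mul, mul_neg, ← mul_assoc, hmul, ← mul_neg]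
  rcases (measureReal_nonneg : 0 ≤ μ.real (ξ.cell w ∩ Z s)).eq_or_lt with h | h
  · rw [← h, zero_mul, zero_mul]
  · have hpos : 0 < μ.real (Z s) := h.trans_le (measureReal_mono Set.inter_subset_right)
    refine mul_le_mul_of_nonneg_left ?_ h.le
    rw [le_neg, ← Real.log_exp (-M s w)]
    refine Real.log_le_log (div_pos h hpos) ?_
    rw [div_le_iff₀ hpos]
    exact hM s hs w

/-! ### The arrangement of the columns -/

/-- The shift of the `i`-th block, a number smaller than `g`: the blocks are grouped into words of
`W` blocks, and the shifts of the blocks of the `j`-th word are the digits of `j` in base `g`. Hence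
every sequence of `W` shifts occurs in exactly one of the first `g ^ W` words. -/
def blockShift (g W i : ℕ) : ℕ := i / W / g ^ (i % W) % g

/-- The position of the `l`-th column. The columns, of height `g`, are grouped into blocks of `Q`
columns without spacers in between; the `i`-th block starts at `i * ((Q + 1) * g)` plus its
shift. -/
def blockPos (Q g W l : ℕ) : ℕ :=
  l / Q * ((Q + 1) * g) + blockShift g W (l / Q) + l % Q * g

/-- The number of spacers above the `l`-th column, if the columns are positioned at `blockPos`. -/
def blockSpacer (Q g W l : ℕ) : ℕ :=
  if (l + 1) % Q = 0 then g + blockShift g W (l / Q + 1) - blockShift g W (l / Q) else 0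

theorem blockShift_lt {g : ℕ} (hg : 0 < g) (W i : ℕ) : blockShift g W i < g := Nat.mod_lt _ hg

theorem sum_blockSpacer {Q g : ℕ} (hg : 0 < g) (W l : ℕ) :
    ∑ i ∈ Finset.range l, (g + blockSpacer Q g W i) = blockPos Q g W l := by
  induction l with
  | zero => simp [blockPos, blockShift]
  | succ l ih =>
    rw [Finset.sum_range_succ, ih, blockPos, blockPos, blockSpacer]
    have hx := blockShift_lt hg W (l / Q)
    have h1 := Nat.div_add_mod l Q
    by_cases h : (l + 1) % Q = 0
    · have hdvd : Q ∣ l + 1 := Nat.dvd_of_mod_eq_zero h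
      have h2 : (l + 1) / Q = l / Q + 1 := Nat.succ_div_of_dvd hdvd
      have h4 := Nat.div_add_mod (l + 1) Q
      have h3 : l % Q + 1 = Q := by
        rw [h2, h, mul_add] at h4
        omega
      rw [if_pos h, h, h2]
      have h5 : (Q + 1) * g = l % Q * g + g + g := by
        calc (Q + 1) * g = (l % Q + 1 + 1) * g := by rw [h3]
          _ = _ := by ring
      rw [add_mul (l / Q), h5]
      omega
    · have hdvd : ¬ Q ∣ l + 1 := fun hd => h (Nat.mod_eq_zero_of_dvd hd)
      have h2 : (l + 1) / Q = l / Q := Nat.succ_div_of_not_dvd hdvd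
      have h4 := Nat.div_add_mod (l + 1) Q
      have h3 : (l + 1) % Q = l % Q + 1 := by
        rw [h2] at h4
        omega
      rw [if_neg h, h2, h3]
      ring

/-- Away from the first and the last `g` positions, the position `r` in the `i`-th slot of length
`(Q + 1) * g` belongs to the `i`-th block, whose shift determines the level there. -/
theorem exists_blockPos_add_eq {Q g W i r : ℕ} (hg : 0 < g) (hr : g ≤ r) (hr' : r < Q * g) :
    ∃ l < Q, i * ((Q + 1) * g) + r =
      (r - blockShift g W i) % g + blockPos Q g W (i * Q + l) := by
  have hx := blockShift_lt hg W i
  have hl : (r - blockShift g W i) / g < Q := by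
    rw [Nat.div_lt_iff_lt_mul hg]; omega
  have hQ : 0 < Q := (Nat.zero_le _).trans_lt hl
  refine ⟨_, hl, ?_⟩
  have h1 : (i * Q + (r - blockShift g W i) / g) / Q = i := by
    rw [add_comm, Nat.add_mul_div_right _ _ hQ, Nat.div_eq_of_lt hl, zero_add]
  have h2 : (i * Q + (r - blockShift g W i) / g) % Q = (r - blockShift g W i) / g := by
    rw [add_comm, Nat.add_mul_mod_self_right, Nat.mod_eq_of_lt hl]
  rw [blockPos, h1, h2]
  have h3 := Nat.div_add_mod (r - blockShift g W i) g
  rw [mul_comm g] at h3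
  omega

/-- Distinct digits of a number that is uniformly distributed in `[0, g ^ W)` are independent. -/
theorem card_digits_mul_le {κ : Type*} {g W D : ℕ} (K : Finset κ) (d : κ → ℕ)
    (hd : ∀ k ∈ K, d k < W) (hinj : Set.InjOn d K) (S : κ → Finset ℕ)
    (hS : ∀ k ∈ K, (S k).card ≤ D) :
    ((Finset.range (g ^ W)).filter fun j => ∀ k ∈ K, j / g ^ d k % g ∈ S k).card * g ^ K.card ≤
      g ^ W * D ^ K.card := by
  classical
  let R : Fin W → Finset (Fin g) := fun b =>
    Finset.univ.filter fun y => ∀ k ∈ K, d k = b → (y : ℕ) ∈ S k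
  have hcard : ((Finset.range (g ^ W)).filter fun j => ∀ k ∈ K, j / g ^ d k % g ∈ S k).card ≤
      (Fintype.piFinset R).card := by
    refine le_trans (Finset.card_le_card ?_)
      (Finset.card_image_le (f := fun f : Fin W → Fin g => (finFunctionFinEquiv f : ℕ)))
    intro j hj
    rw [Finset.mem_filter, Finset.mem_range] at hj
    refine Finset.mem_image.2 ⟨finFunctionFinEquiv.symm ⟨j, hj.1⟩, ?_, by simp⟩
    rw [Fintype.mem_piFinset]
    intro b
    refine Finset.mem_filter.2 ⟨Finset.mem_univ _, fun k hk hkb => ?_⟩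
    have := hj.2 k hk
    rw [hkb] at this
    exact this
  let Bs : Finset (Fin W) := Finset.univ.filter fun b => (b : ℕ) ∈ K.image d
  have hBs : Bs.card = K.card := by
    rw [← Finset.card_image_of_injOn hinj, ← Finset.card_map Fin.valEmbedding]
    congr 1
    ext b
    simp only [Bs, Finset.mem_map, Finset.mem_filter, Finset.mem_univ, true_and,
      Fin.valEmbedding_apply]
    constructor
    · rintro ⟨b, hb, rfl⟩
      exact hb
    · intro hb
      obtain ⟨k, hk, rfl⟩ := Finset.mem_image.1 hb
      exact ⟨⟨d k, hd k hk⟩, hb, rfl⟩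
  have hle : K.card ≤ W := by
    rw [← hBs]
    exact (Finset.card_le_univ _).trans_eq (Fintype.card_fin W)
  have h1 : ∏ b ∈ Bs, (R b).card ≤ D ^ K.card := by
    rw [← hBs]
    refine Finset.prod_le_pow_card _ _ _ fun b hb => ?_
    obtain ⟨k, hk, hkb⟩ := Finset.mem_image.1 (Finset.mem_filter.1 hb).2
    refine le_trans ?_ (hS k hk)
    refine Finset.card_le_card_of_injOn (fun y => (y : ℕ))
      (fun y hy => (Finset.mem_filter.1 hy).2 k hk hkb) fun y _ y' _ h => Fin.ext h
  have h2 : ∏ b ∈ Bsᶜ, (R b).card ≤ g ^ (W - K.card) := by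
    have : Bsᶜ.card = W - K.card := by rw [Finset.card_compl, Fintype.card_fin, hBs]
    rw [← this]
    exact Finset.prod_le_pow_card _ _ _ fun b _ =>
      (Finset.card_le_univ _).trans_eq (Fintype.card_fin g)
  calc _ ≤ (∏ b, (R b).card) * g ^ K.card := by
        rw [← Fintype.card_piFinset]
        exact Nat.mul_le_mul_right _ hcard
    _ = (∏ b ∈ Bs, (R b).card) * (∏ b ∈ Bsᶜ, (R b).card) * g ^ K.card := by
        rw [Finset.prod_mul_prod_compl]
    _ ≤ D ^ K.card * g ^ (W - K.card) * g ^ K.card := by gcongr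
    _ = g ^ W * D ^ K.card := by
        rw [mul_assoc, ← pow_add, Nat.sub_add_cancel hle, mul_comm]

theorem card_filter_sub_mod_le {g r : ℕ} (hr : g ≤ r) (V : Finset ℕ) :
    ((Finset.range g).filter fun x => (r - x) % g ∈ V).card ≤ V.card := by
  refine Finset.card_le_card_of_injOn (fun x => (r - x) % g)
    (fun x hx => (Finset.mem_filter.1 hx).2) ?_
  intro x hx y hy h
  have hx' := Finset.mem_range.1 (Finset.mem_filter.1 hx).1
  have hy' := Finset.mem_range.1 (Finset.mem_filter.1 hy).1
  wlog hxy : x ≤ y generalizing x y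
  · exact (this hy hx h.symm hy' hx' (le_of_not_ge hxy)).symm
  have h1 : g ∣ (r - x) - (r - y) := (Nat.modEq_iff_dvd' (by omega)).1 h.symm
  have h2 := Nat.eq_zero_of_dvd_of_lt h1 (by omega)
  omega

theorem card_filter_add_mod (b t P : ℕ) (p : ℕ → Prop) [DecidablePred p] :
    ((Finset.range (b * P)).filter fun s => p ((s + t) % P)).card =
      b * ((Finset.range P).filter p).card := by
  have hper : Function.Periodic (fun s => p (s % P)) P := fun s => by simp
  have hone : ∀ m, ((Finset.Ico m (m + P)).filter fun s => p (s % P)).card =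
      ((Finset.range P).filter p).card := by
    intro m
    rw [Nat.filter_Ico_card_eq_of_periodic m P _ hper, Nat.count_eq_card_filter_range]
    congr 1
    exact Finset.filter_congr fun s hs => by rw [Nat.mod_eq_of_lt (Finset.mem_range.1 hs)]
  induction b with
  | zero => simp
  | succ b ih =>
    rw [add_mul, one_mul, Finset.range_eq_Ico,
      ← Finset.Ico_union_Ico_eq_Ico (Nat.zero_le (b * P)) (Nat.le_add_right _ P),
      Finset.filter_union, Finset.card_union_of_disjoint, ← Finset.range_eq_Ico, ih, add_mul,
      one_mul, ← hone (b * P + t)]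
    · congr 1
      refine Finset.card_bij (fun s _ => s + t) ?_ ?_ ?_
      · intro s hs
        simp only [Finset.mem_filter, Finset.mem_Ico] at hs ⊢
        exact ⟨by omega, hs.2⟩
      · intro s _ s' _ h
        omega
      · intro s hs
        simp only [Finset.mem_filter, Finset.mem_Ico] at hs
        refine ⟨s - t, ?_, by omega⟩
        simp only [Finset.mem_filter, Finset.mem_Ico]
        exact ⟨by omega, by rw [Nat.sub_add_cancel (by omega)]; exact hs.2⟩
    · exact Finset.disjoint_filter_filter (Finset.Ico_disjoint_Ico_consecutive _ _ _)

/-- The starting points `s` for which the time `t` falls into the window in which the shifts are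
visible. -/
theorem card_filter_window {Q g b t : ℕ} :
    ((Finset.range (b * ((Q + 1) * g))).filter fun s =>
      g ≤ (s + t) % ((Q + 1) * g) ∧ (s + t) % ((Q + 1) * g) < Q * g).card =
      b * ((Q - 1) * g) := by
  rw [card_filter_add_mod b t _ (fun r => g ≤ r ∧ r < Q * g)]
  congr 1
  have : (Finset.range ((Q + 1) * g)).filter (fun r => g ≤ r ∧ r < Q * g) =
      Finset.Ico g (Q * g) := by
    ext r
    simp only [Finset.mem_filter, Finset.mem_range, Finset.mem_Ico, add_mul, one_mul]
    omega
  rw [this, Nat.card_Ico, Nat.sub_mul, one_mul]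

/-! ### Stages with independent shifts -/

/-- At stage `n`, the columns are arranged in blocks of `Q` columns, shifted as in `blockPos`. -/
structure IsBlockStage (q : ℕ → ℕ) (a : ℕ → ℕ → ℕ) (n Q W : ℕ) : Prop where
  height_pos : 0 < towerHeight q a n
  Q_pos : 0 < Q
  W_pos : 0 < W
  q_eq : q n = Q * (W * towerHeight q a n ^ W)
  a_eq : ∀ l, a n l = blockSpacer Q (towerHeight q a n) W l

namespace IsBlockStage

variable {q : ℕ → ℕ} {a : ℕ → ℕ → ℕ} {n Q W : ℕ}

theorem columnPos_eq (hs : IsBlockStage q a n Q W) (l : ℕ) :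
    columnPos q a n l = blockPos Q (towerHeight q a n) W l := by
  simp only [columnPos, hs.a_eq]
  exact sum_blockSpacer hs.height_pos W l

/-- The top block ends `g` below the end of its slot, apart from its shift `x`. -/
theorem exists_height_succ_eq (hs : IsBlockStage q a n Q W) :
    ∃ x < towerHeight q a n, towerHeight q a (n + 1) + towerHeight q a n =
      W * towerHeight q a n ^ W * ((Q + 1) * towerHeight q a n) + x := by
  have hg := hs.height_pos
  set g := towerHeight q a n with hgdef
  have hG : 0 < W * g ^ W := Nat.mul_pos hs.W_pos (pow_pos hg W)
  obtain ⟨G, hG'⟩ : ∃ G, W * g ^ W = G + 1 := ⟨W * g ^ W - 1, by omega⟩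
  obtain ⟨Q', hQ'⟩ : ∃ Q', Q = Q' + 1 := ⟨Q - 1, by have := hs.Q_pos; omega⟩
  have hq1 : 1 ≤ q n := by rw [hs.q_eq]; exact Nat.mul_pos hs.Q_pos hG
  have hl : q n - 1 = G * Q + Q' := by
    rw [hs.q_eq, ← hgdef, hG', hQ', Nat.mul_comm, Nat.add_mul]
    omega
  have h1 : (G * Q + Q') / Q = G := by
    rw [add_comm, Nat.add_mul_div_right _ _ hs.Q_pos, Nat.div_eq_of_lt (by omega), zero_add]
  have h2 : (G * Q + Q') % Q = Q' := by
    rw [add_comm, Nat.add_mul_mod_self_right, Nat.mod_eq_of_lt (by omega)]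
  have h3 : towerHeight q a (n + 1) = columnPos q a n (q n - 1) + g := (columnPos_last hq1).symm
  refine ⟨blockShift g W G, blockShift_lt hg W G, ?_⟩
  rw [h3, hs.columnPos_eq, ← hgdef, hl, blockPos, h1, h2, hG', hQ']
  ring

theorem height_succ_le (hs : IsBlockStage q a n Q W) :
    towerHeight q a (n + 1) ≤ W * towerHeight q a n ^ W * ((Q + 1) * towerHeight q a n) := by
  obtain ⟨x, hx, h⟩ := hs.exists_height_succ_eq
  omega

theorem le_height_succ (hs : IsBlockStage q a n Q W) :
    W * towerHeight q a n ^ W * ((Q + 1) * towerHeight q a n) ≤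
      towerHeight q a (n + 1) + towerHeight q a n := by
  obtain ⟨x, hx, h⟩ := hs.exists_height_succ_eq
  omega

variable {X : Type*} [MeasurableSpace X] {μ : Measure X} {T : X ≃ᵐ X} {F : ℕ → Set X}
  {E : ℕ → ℕ → Set X} {C : ℕ → ℕ → ℕ → Set X}

/-- The level of the tower of stage `n` reached at time `t` from the level `j * (W * P) + s` of the
next tower, `P` being the length of a block: it depends on `j` only through one of its digits. -/
theorem image_level_subset (hs : IsBlockStage q a n Q W) (H : IsCutAndStack μ T q a F E C)
    {g P : ℕ} (hg : g = towerHeight q a n) (hP : P = (Q + 1) * g) {j s t : ℕ} (hj : j < g ^ W)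
    (hst : s + t < W * P) (hr : g ≤ (s + t) % P) (hr' : (s + t) % P < Q * g) :
    (⇑T)^[t] '' ((⇑T)^[j * (W * P) + s] '' F (n + 1)) ⊆
      (⇑T)^[((s + t) % P - j / g ^ ((s + t) / P) % g) % g] '' F n := by
  have hgpos : 0 < g := hg ▸ hs.height_pos
  have hPpos : 0 < P := by rw [hP]; positivity
  have hd : (s + t) / P < W := Nat.div_lt_of_lt_mul (by rwa [mul_comm])
  set d := (s + t) / P with hddef
  set r := (s + t) % P with hrdef
  have hdiv : P * d + r = s + t := Nat.div_add_mod (s + t) P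
  obtain ⟨l, hl, hlr⟩ := exists_blockPos_add_eq (W := W) (i := j * W + d) hgpos hr hr'
  have hshift : blockShift g W (j * W + d) = j / g ^ d % g := by
    have h1 : (j * W + d) / W = j := by
      rw [add_comm, Nat.add_mul_div_right _ _ hs.W_pos, Nat.div_eq_of_lt hd, zero_add]
    have h2 : (j * W + d) % W = d := by
      rw [add_comm, Nat.add_mul_mod_self_right, Nat.mod_eq_of_lt hd]
    rw [blockShift, h1, h2]
  rw [hshift, ← hP] at hlr
  have hlq : (j * W + d) * Q + l < q n := by
    rw [hs.q_eq, ← hg]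
    have h1 : j * W + d + 1 ≤ W * g ^ W := by
      calc j * W + d + 1 ≤ j * W + W := by omega
        _ = W * (j + 1) := by ring
        _ ≤ W * g ^ W := Nat.mul_le_mul_left _ hj
    calc (j * W + d) * Q + l < (j * W + d) * Q + Q := by omega
      _ = Q * (j * W + d + 1) := by ring
      _ ≤ _ := Nat.mul_le_mul_left _ h1
  have htime : t + (j * (W * P) + s) = (r - j / g ^ d % g) % g +
      columnPos q a n ((j * W + d) * Q + l) := by
    rw [hs.columnPos_eq, ← hg, ← hlr]
    calc t + (j * (W * P) + s) = j * (W * P) + (s + t) := by ring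
      _ = _ := by rw [← hdiv]; ring
  rw [iterate_image_iterate_image, htime, ← iterate_image_iterate_image, ← H.sub_eq hlq]
  refine Set.image_mono ?_
  rw [← H.union_sub]
  exact Set.subset_biUnion_of_mem (u := fun i => E n i)
    (Finset.mem_coe.2 (Finset.mem_range.2 hlq))

end IsBlockStage

theorem measureReal_sum_inter_ge {X σ : Type*} [MeasurableSpace X] {μ : Measure X}
    [IsProbabilityMeasure μ] {S : Finset σ} {Z : σ → Set X} (hZ : ∀ s ∈ S, MeasurableSet (Z s))
    (hdisj : (S : Set σ).PairwiseDisjoint Z) {A : Set X} (hA : MeasurableSet A) :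
    ∑ s ∈ S, μ.real (Z s) - (1 - μ.real A) ≤ ∑ s ∈ S, μ.real (A ∩ Z s) := by
  have h1 : ∑ s ∈ S, μ.real (Z s) = ∑ s ∈ S, μ.real (A ∩ Z s) + ∑ s ∈ S, μ.real (Z s \ A) := by
    rw [← Finset.sum_add_distrib]
    refine Finset.sum_congr rfl fun s _ => ?_
    rw [Set.inter_comm, measureReal_inter_add_sdiff hA]
  have h2 : ∑ s ∈ S, μ.real (Z s \ A) ≤ μ.real Aᶜ := by
    rw [← measureReal_biUnion_finset]
    · exact measureReal_mono (Set.iUnion₂_subset fun s _ => fun x hx => hx.2)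
    · exact fun s hs t ht hst => (hdisj hs ht hst).mono Set.sdiff_subset Set.sdiff_subset
    · exact fun s hs => (hZ s hs).diff hA
  rw [probReal_compl_eq_one_sub hA] at h2
  linarith

namespace IsCutAndStack

variable {X : Type*} [MeasurableSpace X] {μ : Measure X} {T : X ≃ᵐ X}
  {q : ℕ → ℕ} {a : ℕ → ℕ → ℕ} {F : ℕ → Set X} {E : ℕ → ℕ → Set X} {C : ℕ → ℕ → ℕ → Set X}

/-- The copies of the column of stage `m` in the tower of stage `n` do not overlap. -/
theorem card_mul_height_le [IsFiniteMeasure μ] (H : IsCutAndStack μ T q a F E C)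
    (hT : MeasurePreserving T μ μ)
    {m n : ℕ} (hmn : m ≤ n) (hm : 0 < μ.real (tower T q a F m)) {V : Finset ℕ}
    (hV : ∀ v ∈ V, v + towerHeight q a m ≤ towerHeight q a n)
    (hF : F m = ⋃ v ∈ V, (⇑T)^[v] '' F n) :
    V.card * towerHeight q a m ≤ towerHeight q a n := by
  have hhm : 0 < towerHeight q a m := towerHeight_pos H.q_pos m
  have h1 : μ.real (F m) = V.card * μ.real (F n) := by
    conv_lhs => rw [hF]
    exact H.measureReal_biUnion_level hT fun v hv => by have := hV v hv; omega
  have h2 : μ.real (tower T q a F m) ≤ μ.real (tower T q a F n) :=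
    measureReal_mono (H.tower_mono hmn)
  have h3 : 0 < μ.real (F n) := by
    have := hm.trans_le h2
    rw [H.measureReal_tower hT] at this
    exact pos_of_mul_pos_right this (Nat.cast_nonneg _)
  rw [H.measureReal_tower hT, H.measureReal_tower hT, h1] at h2
  have h4 : ((V.card * towerHeight q a m : ℕ) : ℝ) * μ.real (F n) ≤
      (towerHeight q a n : ℝ) * μ.real (F n) := by
    push_cast
    linarith
  exact_mod_cast le_of_mul_le_mul_right h4 h3

/-- The points of the tower of stage `n + 1` in the levels congruent to `s` modulo the length of a
word. -/
def wordLevel (T : X ≃ᵐ X) (F : ℕ → Set X) (n g W P s : ℕ) : Set X :=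
  ⋃ j ∈ Finset.range (g ^ W), (⇑T)^[j * (W * P) + s] '' F (n + 1)

theorem measurableSet_wordLevel (H : IsCutAndStack μ T q a F E C) (n g W P s : ℕ) :
    MeasurableSet (wordLevel T F n g W P s) :=
  Finset.measurableSet_biUnion _ fun _ _ => H.measurableSet_level _ _

theorem measureReal_biUnion_word [IsFiniteMeasure μ] (H : IsCutAndStack μ T q a F E C)
    (hT : MeasurePreserving T μ μ) {n s p : ℕ} (hp : 0 < p) {I : Finset ℕ}
    (hI : ∀ j ∈ I, j * p + s < towerHeight q a (n + 1)) :
    μ.real (⋃ j ∈ I, (⇑T)^[j * p + s] '' F (n + 1)) = I.card * μ.real (F (n + 1)) := by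
  classical
  have hinj : Function.Injective fun j : ℕ => j * p + s := fun j j' h =>
    Nat.eq_of_mul_eq_mul_right hp (Nat.add_right_cancel h)
  have := H.measureReal_biUnion_level hT (n := n + 1)
    (I := I.image fun j => j * p + s) (fun k hk => by
      obtain ⟨j, hj, rfl⟩ := Finset.mem_image.1 hk
      exact hI j hj)
  rwa [Finset.set_biUnion_finset_image, Finset.card_image_of_injective _ hinj] at this

theorem measureReal_wordLevel [IsFiniteMeasure μ] (H : IsCutAndStack μ T q a F E C)
    (hT : MeasurePreserving T μ μ) {n g W P s : ℕ} (hWP : 0 < W * P)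
    (hlev : ∀ j < g ^ W, j * (W * P) + s < towerHeight q a (n + 1)) :
    μ.real (wordLevel T F n g W P s) = (g ^ W : ℕ) * μ.real (F (n + 1)) := by
  rw [wordLevel, H.measureReal_biUnion_word hT hWP fun j hj => hlev j (Finset.mem_range.1 hj),
    Finset.card_range]

/-- The set `K` consists of times at which the point is in a block with a well defined shift, and at
which the cell `w` prescribes a level of the tower of stage `m`; each of them divides the
conditional measure by the number of these levels. -/
theorem measureReal_cell_inter_le [IsFiniteMeasure μ] (H : IsCutAndStack μ T q a F E C)
    (hT : MeasurePreserving T μ μ) {m n Q W N : ℕ} (hs : IsBlockStage q a n Q W) (hmn : m ≤ n)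
    (hm : 0 < μ.real (tower T q a F m)) {g P : ℕ} (hg : g = towerHeight q a n)
    (hP : P = (Q + 1) * g) {t : Fin N → ℕ} {s : ℕ}
    (hlev : ∀ j < g ^ W, j * (W * P) + s < towerHeight q a (n + 1)) {K : Finset (Fin N)}
    (hK : ∀ k ∈ K, s + t k < W * P ∧ g ≤ (s + t k) % P ∧ (s + t k) % P < Q * g)
    (hinj : Set.InjOn (fun k => (s + t k) / P) K) (w : Fin N → Fin (towerHeight q a m + 1))
    (hw : ∀ k ∈ K, (w k : ℕ) < towerHeight q a m) :
    μ.real ((MeasurablePartition.join fun k => (H.levelPartition m).pullback (⇑T)^[t k]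
      (T.measurable.iterate (t k))).cell w ∩ wordLevel T F n g W P s) ≤
      Real.exp (-(K.card * Real.log (towerHeight q a m))) * μ.real (wordLevel T F n g W P s) := by
  classical
  have hgpos : 0 < g := hg ▸ hs.height_pos
  have hPpos : 0 < P := by rw [hP]; positivity
  have hhm : 0 < towerHeight q a m := towerHeight_pos H.q_pos m
  have hWP : 0 < W * P := Nat.mul_pos hs.W_pos hPpos
  obtain ⟨V, hV, hF⟩ := H.exists_base_eq hmn
  have hcard := H.card_mul_height_le hT hmn hm hV hF
  rw [← hg] at hcard hV
  let S : Fin N → Finset ℕ := fun k =>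
    (Finset.range g).filter fun x => ((s + t k) % P - x) % g ∈ V.image (· + (w k : ℕ))
  let I : Finset ℕ := (Finset.range (g ^ W)).filter fun j =>
    ∀ k ∈ K, j / g ^ ((s + t k) / P) % g ∈ S k
  have hI : I.card * towerHeight q a m ^ K.card ≤ g ^ W := by
    have h0 := card_digits_mul_le (g := g) (W := W) (D := V.card) K (fun k => (s + t k) / P)
      (fun k hk => Nat.div_lt_of_lt_mul (by rw [mul_comm]; exact (hK k hk).1)) hinj S
      (fun k hk => (card_filter_sub_mod_le (hK k hk).2.1 _).trans Finset.card_image_le)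
    have h1 : I.card * g ^ K.card ≤ g ^ W * V.card ^ K.card := by convert h0
    refine Nat.le_of_mul_le_mul_right ?_ (pow_pos hgpos K.card)
    calc I.card * towerHeight q a m ^ K.card * g ^ K.card
        = I.card * g ^ K.card * towerHeight q a m ^ K.card := by ring
      _ ≤ g ^ W * V.card ^ K.card * towerHeight q a m ^ K.card := Nat.mul_le_mul_right _ h1
      _ = g ^ W * (V.card * towerHeight q a m) ^ K.card := by rw [mul_pow]; ring
      _ ≤ g ^ W * g ^ K.card := Nat.mul_le_mul_left _ (Nat.pow_le_pow_left hcard _)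
  have hsub : (MeasurablePartition.join fun k => (H.levelPartition m).pullback (⇑T)^[t k]
      (T.measurable.iterate (t k))).cell w ∩ wordLevel T F n g W P s ⊆
      ⋃ j ∈ I, (⇑T)^[j * (W * P) + s] '' F (n + 1) := by
    rintro x ⟨hx, hxZ⟩
    obtain ⟨j, hj, hxj⟩ := Set.mem_iUnion₂.1 hxZ
    refine Set.mem_iUnion₂.2 ⟨j, Finset.mem_filter.2 ⟨hj, fun k hk => ?_⟩, hxj⟩
    obtain ⟨hk1, hk2, hk3⟩ := hK k hk
    have h1 : (⇑T)^[t k] x ∈ (⇑T)^[(w k : ℕ)] '' F m := by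
      have h2 : (⇑T)^[t k] x ∈ ((H.levelPartition m).cell (w k)) := Set.mem_iInter.1 hx k
      simpa only [levelPartition, if_pos (hw k hk)] using h2
    have h2 := hs.image_level_subset H hg hP (Finset.mem_range.1 hj) hk1 hk2 hk3
      (Set.mem_image_of_mem _ hxj)
    rw [hF, Set.image_iUnion₂] at h1
    obtain ⟨v, hv, h1⟩ := Set.mem_iUnion₂.1 h1
    rw [iterate_image_iterate_image] at h1
    refine Finset.mem_filter.2 ⟨Finset.mem_range.2 (Nat.mod_lt _ hgpos), ?_⟩
    by_contra hne
    refine Set.disjoint_left.1 (H.disjoint_levels n _ ?_ _ ?_ ?_) h1 h2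
    · have h3 := hV v hv
      have h4 := hw k hk
      omega
    · rw [← hg]
      exact Nat.mod_lt _ hgpos
    · intro h
      refine hne ?_
      rw [← h]
      exact Finset.mem_image.2 ⟨v, hv, add_comm _ _⟩
  have hexp : Real.exp (-(K.card * Real.log (towerHeight q a m))) =
      ((towerHeight q a m : ℝ) ^ K.card)⁻¹ := by
    rw [Real.exp_neg, Real.exp_nat_mul, Real.exp_log (by exact_mod_cast hhm)]
  calc _ ≤ μ.real (⋃ j ∈ I, (⇑T)^[j * (W * P) + s] '' F (n + 1)) :=
        measureReal_mono hsub (measure_ne_top _ _)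
    _ = I.card * μ.real (F (n + 1)) :=
        H.measureReal_biUnion_word hT hWP fun j hj =>
          hlev j (Finset.mem_range.1 (Finset.mem_filter.1 hj).1)
    _ ≤ _ := by
        rw [H.measureReal_wordLevel hT hWP hlev, hexp, ← mul_assoc]
        refine mul_le_mul_of_nonneg_right ?_ measureReal_nonneg
        rw [inv_mul_eq_div, le_div_iff₀ (by positivity)]
        exact_mod_cast hI

/-- If the times in `J` are further apart than the length `P` of a block, then the points at these
times lie in blocks with independent shifts, so the entropy is at least proportional to `J.card`. -/
theorem le_entropy_join [IsProbabilityMeasure μ] (H : IsCutAndStack μ T q a F E C)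
    (hT : MeasurePreserving T μ μ) {m n Q D N : ℕ} (hs : IsBlockStage q a n Q (8 * D))
    (hmn : m ≤ n) (hQ : 16 ≤ Q) (hm : 7 / 8 ≤ μ.real (tower T q a F m)) {g P : ℕ}
    (hg : g = towerHeight q a n) (hP : P = (Q + 1) * g) {t : Fin N → ℕ} (ht : ∀ k, t k ≤ D * P)
    {J : Finset (Fin N)}
    (hsep : ∀ k ∈ J, ∀ k' ∈ J, k ≠ k' → t k + P ≤ t k' ∨ t k' + P ≤ t k) :
    J.card * (Real.log (towerHeight q a m) / 2) ≤
      (MeasurablePartition.join fun k => (H.levelPartition m).pullback (⇑T)^[t k]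
        (T.measurable.iterate (t k))).entropy μ := by
  classical
  have hgpos : 0 < g := hg ▸ hs.height_pos
  have hgP : g < P := by rw [hP]; nlinarith
  have hPpos : 0 < P := by omega
  have hD : 0 < D := by have := hs.W_pos; omega
  have hWP : 0 < 8 * D * P := Nat.mul_pos hs.W_pos hPpos
  have hhm : 0 < towerHeight q a m := towerHeight_pos H.q_pos m
  set ξ := MeasurablePartition.join fun k => (H.levelPartition m).pullback (⇑T)^[t k]
    (T.measurable.iterate (t k)) with hξ
  let L := Real.log (towerHeight q a m)
  have hL : 0 ≤ L := Real.log_natCast_nonneg _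
  let Z : ℕ → Set X := wordLevel T F n g (8 * D) P
  have hZm : ∀ s, MeasurableSet (Z s) := H.measurableSet_wordLevel n g (8 * D) P
  -- From these starting points the word is not left up to the time `D * P`.
  let S : Finset ℕ := Finset.range (7 * D * P)
  have hS : ∀ s ∈ S, s + D * P < 8 * D * P := by
    intro s h
    have h1 := Finset.mem_range.1 h
    have h2 : 8 * D * P = 7 * D * P + D * P := by ring
    omega
  have hlev : ∀ s ∈ S, ∀ j < g ^ (8 * D), j * (8 * D * P) + s < towerHeight q a (n + 1) := by
    intro s h j hj
    have h1 := hs.le_height_succ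
    rw [← hg, ← hP] at h1
    have h2 := hS s h
    have h3 : P ≤ D * P := Nat.le_mul_of_pos_left _ hD
    have h4 : (j + 1) * (8 * D * P) ≤ g ^ (8 * D) * (8 * D * P) := Nat.mul_le_mul_right _ hj
    have h5 : 8 * D * g ^ (8 * D) * P = g ^ (8 * D) * (8 * D * P) := by ring
    rw [add_mul, one_mul] at h4
    omega
  have hdisj : (S : Set ℕ).PairwiseDisjoint Z := by
    intro s h s' h' hne
    have h1 := hS s h
    have h2 := hS s' h'
    refine Set.disjoint_left.2 fun x hx hx' => ?_
    obtain ⟨j, hj, hxj⟩ := Set.mem_iUnion₂.1 hx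
    obtain ⟨j', hj', hxj'⟩ := Set.mem_iUnion₂.1 hx'
    refine Set.disjoint_left.1 (H.disjoint_levels (n + 1) _ (hlev s h j (Finset.mem_range.1 hj)) _
      (hlev s' h' j' (Finset.mem_range.1 hj')) fun heq => hne ?_) hxj hxj'
    have h3 := congrArg (· % (8 * D * P)) heq
    simp only [Nat.mul_add_mod_self_right] at h3
    rwa [Nat.mod_eq_of_lt (by omega), Nat.mod_eq_of_lt (by omega)] at h3
  let good : ℕ → Fin N → Prop := fun s k => g ≤ (s + t k) % P ∧ (s + t k) % P < Q * g
  let K : ℕ → (Fin N → Fin (towerHeight q a m + 1)) → Finset (Fin N) := fun s w =>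
    J.filter fun k => good s k ∧ (w k : ℕ) < towerHeight q a m
  have hmain := ξ.sum_le_entropy (μ := μ) (S := S) (Z := Z) (fun s _ => hZm s) hdisj
    (fun s w => (K s w).card * L) (fun s h w => by
      refine H.measureReal_cell_inter_le hT hs hmn (by linarith) hg hP (hlev s h) (K := K s w)
        (fun k hk => ?_) ?_ w fun k hk => (Finset.mem_filter.1 hk).2.2
      · have h1 := ht k
        have h2 := hS s h
        exact ⟨by omega, (Finset.mem_filter.1 hk).2.1⟩
      · intro k hk k' hk' heq
        by_contra hne
        have hlt : ∀ u u' : ℕ, u + P ≤ u' → (s + u) / P < (s + u') / P := fun u u' h =>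
          calc (s + u) / P < (s + u) / P + 1 := Nat.lt_succ_self _
            _ = (s + u + P) / P := (Nat.add_div_right _ hPpos).symm
            _ ≤ (s + u') / P := Nat.div_le_div_right (by omega)
        rcases hsep k (Finset.mem_filter.1 hk).1 k' (Finset.mem_filter.1 hk').1 hne with h | h
        · exact (hlt _ _ h).ne heq
        · exact (hlt _ _ h).ne' heq)
  refine le_trans ?_ hmain
  let A : Fin N → Set X := fun k => (⇑T)^[t k] ⁻¹' tower T q a F m
  have hA : ∀ k, MeasurableSet (A k) := fun k =>
    T.measurable.iterate (t k) (H.measurableSet_tower m)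
  have hμA : ∀ k, 7 / 8 ≤ μ.real (A k) := fun k => by
    rw [Measure.real,
      (hT.iterate (t k)).measure_preimage (H.measurableSet_tower m).nullMeasurableSet]
    exact hm
  -- A point of `A k` is in one of the cells `w` that prescribe a level at time `t k`.
  have hcells : ∀ k s, μ.real (A k ∩ Z s) ≤
      ∑ w, if (w k : ℕ) < towerHeight q a m then μ.real (ξ.cell w ∩ Z s) else 0 := by
    intro k s
    rw [← Finset.sum_filter]
    refine le_trans (measureReal_mono (fun x hx => ?_) (measure_ne_top _ _))
      (measureReal_biUnion_finset_le _ _)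
    obtain ⟨w, hw⟩ := Set.mem_iUnion.1 ((ξ.iUnion_cell).symm ▸ Set.mem_univ x)
    refine Set.mem_iUnion₂.2 ⟨w, Finset.mem_filter.2 ⟨Finset.mem_univ _, ?_⟩, hw, hx.2⟩
    by_contra hlt
    have h2 : (⇑T)^[t k] x ∈ ((H.levelPartition m).cell (w k)) := Set.mem_iInter.1 hw k
    simp only [levelPartition, if_neg hlt] at h2
    exact h2 hx.1
  have hgood : ∀ k, 1 / 2 ≤ ∑ s ∈ S, if good s k then μ.real (A k ∩ Z s) else 0 := by
    intro k
    rw [← Finset.sum_filter]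
    have hsub : S.filter (fun s => good s k) ⊆ S := Finset.filter_subset _ _
    have h1 := measureReal_sum_inter_ge (μ := μ) (S := S.filter fun s => good s k) (Z := Z)
      (fun s _ => hZm s) (hdisj.subset (Finset.coe_subset.2 hsub)) (hA k)
    have h2 : ∑ s ∈ S.filter (fun s => good s k), μ.real (Z s) =
        (7 * D * ((Q - 1) * g) : ℕ) * ((g ^ (8 * D) : ℕ) * μ.real (F (n + 1))) := by
      rw [Finset.sum_congr rfl fun s h => H.measureReal_wordLevel hT hWP (hlev s (hsub h)),
        Finset.sum_const, nsmul_eq_mul]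
      congr 2
      simp only [S, good, hP]
      exact card_filter_window
    have h3 : 7 / 8 ≤ μ.real (tower T q a F (n + 1)) :=
      hm.trans (measureReal_mono (H.tower_mono (by omega)))
    rw [H.measureReal_tower hT] at h3
    have h4 := hs.height_succ_le
    rw [← hg] at h4
    set y : ℝ := D * g * (g : ℝ) ^ (8 * D) * μ.real (F (n + 1)) with hy
    have hy0 : 0 ≤ y := by positivity
    have h5 : 7 / 8 ≤ 8 * ((Q : ℝ) + 1) * y := by
      have h6 : (towerHeight q a (n + 1) : ℝ) ≤ 8 * D * (g : ℝ) ^ (8 * D) * ((Q + 1) * g) := by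
        exact_mod_cast h4
      calc 7 / 8 ≤ (towerHeight q a (n + 1) : ℝ) * μ.real (F (n + 1)) := h3
        _ ≤ 8 * D * (g : ℝ) ^ (8 * D) * ((Q + 1) * g) * μ.real (F (n + 1)) :=
            mul_le_mul_of_nonneg_right h6 measureReal_nonneg
        _ = _ := by rw [hy]; ring
    have h7 : ∑ s ∈ S.filter (fun s => good s k), μ.real (Z s) = 7 * ((Q : ℝ) - 1) * y := by
      rw [h2, hy]
      push_cast [Nat.cast_sub (show 1 ≤ Q by omega)]
      ring
    have hQ' : (16 : ℝ) ≤ Q := by exact_mod_cast hQ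
    have h8 : 0 ≤ ((Q : ℝ) - 16) * y := mul_nonneg (by linarith) hy0
    have h9 := hμA k
    -- The set of good starting points has measure at least `7 / 8 * 15 / 17 * 7 / 8 > 5 / 8`.
    nlinarith
  calc (J.card : ℝ) * (L / 2) = ∑ k ∈ J, 1 / 2 * L := by
        rw [Finset.sum_const, nsmul_eq_mul]; ring
    _ ≤ ∑ k ∈ J, (∑ s ∈ S, if good s k then μ.real (A k ∩ Z s) else 0) * L :=
        Finset.sum_le_sum fun k _ => mul_le_mul_of_nonneg_right (hgood k) hL
    _ ≤ ∑ k ∈ J, (∑ s ∈ S, ∑ w, if good s k ∧ (w k : ℕ) < towerHeight q a m then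
          μ.real (ξ.cell w ∩ Z s) else 0) * L := by
        refine Finset.sum_le_sum fun k _ => mul_le_mul_of_nonneg_right
          (Finset.sum_le_sum fun s _ => ?_) hL
        by_cases h : good s k
        · simpa only [h, if_true, true_and] using hcells k s
        · simp [h]
    _ = _ := by
        rw [← Finset.sum_mul, Finset.sum_comm, Finset.sum_mul]
        refine Finset.sum_congr rfl fun s _ => ?_
        rw [Finset.sum_comm, Finset.sum_mul]
        refine Finset.sum_congr rfl fun w _ => ?_
        rw [← Finset.sum_filter, Finset.sum_const, nsmul_eq_mul]
        ring

end IsCutAndStack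

/-! ### Choice of the parameters -/

/-- Among the first `N` terms of `A` a positive proportion is pairwise further apart than `P`. -/
theorem exists_separated_times {A J : ℕ → ℕ}
    (hdens : 0 < lowerDensity (Set.range J)) (hdil : DilatesToInfinity (A ∘ J)) :
    ∃ δ : ℝ, 0 < δ ∧ ∀ n P : ℕ, ∃ N D : ℕ, n < N ∧ 0 < D ∧ (∀ k < N, A k ≤ D) ∧
      ∃ I : Finset (Fin N), δ * N ≤ I.card ∧
        ∀ k ∈ I, ∀ k' ∈ I, k ≠ k' → A k + P ≤ A k' ∨ A k' + P ≤ A k := by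
  classical
  obtain ⟨ε, hε, hε'⟩ := exists_between hdens
  refine ⟨ε / 2, half_pos hε, fun n P => ?_⟩
  have hev : ∀ᶠ N : ℕ in atTop, ε < ((Set.range J ∩ Set.Iio N).ncard : ℝ) / N :=
    eventually_lt_of_lt_liminf hε' (isBoundedUnder_of ⟨0, fun N => by positivity⟩)
  obtain ⟨i₀, hi₀⟩ := eventually_atTop.1 (hdil.eventually (eventually_ge_atTop (P : ℤ)))
  have hsep : ∀ i, i₀ ≤ i → ∀ i', i < i' → A (J i) + P ≤ A (J i') := by
    intro i hi i' hii'
    induction i', hii' using Nat.le_induction with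
    | base =>
      have := hi₀ i hi
      simp only [Function.comp_apply] at this
      change _ ≤ A (J (i + 1))
      omega
    | succ i' h ih =>
      have := hi₀ i' (by omega)
      simp only [Function.comp_apply] at this
      omega
  -- For `N > 2 * i₀ / ε`, dropping the first `i₀` terms costs at most half of the `ε * N` indices.
  obtain ⟨R, hR⟩ := exists_nat_gt (2 * i₀ / ε)
  obtain ⟨N, hN, hNn, hNR⟩ :=
    (hev.and ((eventually_gt_atTop n).and (eventually_gt_atTop R))).exists
  have hNpos : (0 : ℝ) < N := by exact_mod_cast (Nat.zero_le n).trans_lt hNn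
  refine ⟨N, (Finset.range N).sup A + 1, hNn, Nat.succ_pos _, fun k hk =>
    (Finset.le_sup (f := A) (Finset.mem_range.2 hk)).trans (Nat.le_succ _),
    Finset.univ.filter fun k : Fin N => ∃ i, i₀ ≤ i ∧ J i = k, ?_, ?_⟩
  · set I := Finset.univ.filter fun k : Fin N => ∃ i, i₀ ≤ i ∧ J i = k
    have hsub : Set.range J ∩ Set.Iio N ⊆
        ((I.map Fin.valEmbedding ∪ (Finset.range i₀).image J : Finset ℕ) : Set ℕ) := by
      rintro _ ⟨⟨i, rfl⟩, hi⟩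
      rw [Finset.mem_coe, Finset.mem_union]
      rcases lt_or_ge i i₀ with h | h
      · exact Or.inr (Finset.mem_image_of_mem _ (Finset.mem_range.2 h))
      · refine Or.inl (Finset.mem_map.2 ⟨⟨J i, hi⟩, ?_, rfl⟩)
        exact Finset.mem_filter.2 ⟨Finset.mem_univ _, i, h, rfl⟩
    have hcard : (Set.range J ∩ Set.Iio N).ncard ≤ I.card + i₀ := by
      refine (Set.ncard_le_ncard hsub (Finset.finite_toSet _)).trans ?_
      rw [Set.ncard_coe_finset]
      refine (Finset.card_union_le _ _).trans ?_
      rw [Finset.card_map]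
      exact Nat.add_le_add_left (Finset.card_image_le.trans_eq (Finset.card_range _)) _
    have h1 : ε * N < (Set.range J ∩ Set.Iio N).ncard := (lt_div_iff₀ hNpos).1 hN
    have h2 : ((Set.range J ∩ Set.Iio N).ncard : ℝ) ≤ I.card + i₀ := by exact_mod_cast hcard
    have h3 : 2 * (i₀ : ℝ) < N * ε := by
      rw [← div_lt_iff₀ hε]
      exact hR.trans (by exact_mod_cast hNR)
    linarith
  · intro k hk k' hk' hne
    obtain ⟨i, hi, hik⟩ := (Finset.mem_filter.1 hk).2
    obtain ⟨i', hi', hik'⟩ := (Finset.mem_filter.1 hk').2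
    rw [← hik, ← hik']
    rcases lt_trichotomy i i' with h | h | h
    · exact Or.inl (hsep i hi i' h)
    · subst h
      exact absurd (Fin.ext (hik.symm.trans hik')) hne
    · exact Or.inr (hsep i' hi' i h)

/-- The spacers enlarge the tower at stage `n` by a factor of at most `1 + (1 / 2) ^ (n + 4)`, and
the product of these factors stays below `2`. -/
theorem height_le_of_isBlockStage {q : ℕ → ℕ} {a : ℕ → ℕ → ℕ} {W : ℕ → ℕ}
    (hs : ∀ n, IsBlockStage q a n (2 ^ (n + 4)) (W n)) (n : ℕ) :
    (towerHeight q a n : ℝ) ≤ (2 - (1 / 2) ^ n) * ∏ k ∈ Finset.range n, (q k : ℝ) := by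
  induction n with
  | zero => norm_num [towerHeight]
  | succ n ih =>
    set g := towerHeight q a n with hg
    have hstep : (towerHeight q a (n + 1) : ℝ) ≤ (1 + (1 / 2) ^ (n + 4)) * q n * g := by
      have h1 : (towerHeight q a (n + 1) : ℝ) ≤
          W n * (g : ℝ) ^ W n * (((2 : ℝ) ^ (n + 4) + 1) * g) := by
        exact_mod_cast (hs n).height_succ_le
      have h2 : (q n : ℝ) = (2 : ℝ) ^ (n + 4) * (W n * (g : ℝ) ^ W n) := by
        rw [(hs n).q_eq]
        push_cast
        rfl
      refine h1.trans_eq ?_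
      rw [h2]
      have h3 : ((1 : ℝ) / 2) ^ (n + 4) * 2 ^ (n + 4) = 1 := by
        rw [← mul_pow]; norm_num
      linear_combination (-(W n : ℝ) * (g : ℝ) ^ W n * g) * h3
    set x : ℝ := (1 / 2) ^ n with hx
    have hx0 : 0 ≤ x := by positivity
    rw [Finset.prod_range_succ]
    set p : ℝ := ∏ k ∈ Finset.range n, (q k : ℝ) with hp
    have hp0 : 0 ≤ p := Finset.prod_nonneg fun _ _ => Nat.cast_nonneg _
    have e1 : ((1 : ℝ) / 2) ^ (n + 4) = x / 16 := by rw [pow_add, ← hx]; norm_num; ring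
    have e2 : ((1 : ℝ) / 2) ^ (n + 1) = x / 2 := by rw [pow_succ, ← hx]; ring
    rw [e1] at hstep
    rw [e2]
    calc (towerHeight q a (n + 1) : ℝ) ≤ (1 + x / 16) * q n * g := hstep
      _ ≤ (1 + x / 16) * q n * ((2 - x) * p) := by gcongr
      _ = (1 + x / 16) * (2 - x) * (p * q n) := by ring
      _ ≤ (2 - x / 2) * (p * q n) :=
          mul_le_mul_of_nonneg_right (by nlinarith) (mul_nonneg hp0 (Nat.cast_nonneg _))

/-- The word length of a stage may be chosen depending on the height reached before. -/
theorem exists_isBlockStage (W : ℕ → ℕ → ℕ) (hW : ∀ n g, 0 < W n g) :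
    ∃ (q : ℕ → ℕ) (a : ℕ → ℕ → ℕ),
      ∀ n, IsBlockStage q a n (2 ^ (n + 4)) (W n (towerHeight q a n)) := by
  let q' : ℕ → ℕ → ℕ := fun n g => 2 ^ (n + 4) * (W n g * g ^ W n g)
  let a' : ℕ → ℕ → ℕ → ℕ := fun n g => blockSpacer (2 ^ (n + 4)) g (W n g)
  -- The heights are defined first, since the parameters of a stage depend on the height before it.
  let h : ℕ → ℕ := fun n =>
    Nat.rec 1 (fun n g => q' n g * g + ∑ i ∈ Finset.range (q' n g - 1), a' n g i) n
  have hh : ∀ n, towerHeight (fun n => q' n (h n)) (fun n => a' n (h n)) n = h n := by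
    intro n
    induction n with
    | zero => rfl
    | succ n ih => rw [towerHeight, ih]; rfl
  have hpos : ∀ n, 0 < h n := by
    intro n
    induction n with
    | zero => exact Nat.one_pos
    | succ n ih =>
      refine Nat.lt_of_lt_of_le (Nat.mul_pos (Nat.mul_pos (by positivity)
        (Nat.mul_pos (hW n (h n)) (pow_pos ih _))) ih) (Nat.le_add_right _ _)
  exact ⟨fun n => q' n (h n), fun n => a' n (h n), fun n =>
    { height_pos := by rw [hh]; exact hpos n
      Q_pos := by positivity
      W_pos := hW _ _
      q_eq := by rw [hh]
      a_eq := fun l => by rw [hh] }⟩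

end

theorem mainTheorem2 (A : ℕ → ℕ) (hA : ∀ n, 0 < A n) (J : ℕ → ℕ) (hJ : StrictMono J)
    (hdens : 0 < lowerDensity (Set.range J)) (hdil : DilatesToInfinity (A ∘ J)) :
    ∃ (X : Type) (_ : MeasurableSpace X) (_ : StandardBorelSpace X) (μ : Measure X)
      (_ : IsProbabilityMeasure μ) (T : X ≃ᵐ X),
      IsRankOne μ T ∧ seqEntropy μ T A = ⊤ := by
  obtain ⟨δ, hδ, hsep⟩ := exists_separated_times hdens hdil
  choose N D hnN hD hAD I hI hIsep using hsep
  obtain ⟨q, a, hs⟩ := exists_isBlockStage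
    (fun n g => 8 * D n ((2 ^ (n + 4) + 1) * g))
    (fun n g => by have := hD n ((2 ^ (n + 4) + 1) * g); omega)
  have hq : ∀ n, 2 ≤ q n := fun n => by
    rw [(hs n).q_eq]
    have h1 : 0 < 8 * D n ((2 ^ (n + 4) + 1) * towerHeight q a n) *
        towerHeight q a n ^ (8 * D n ((2 ^ (n + 4) + 1) * towerHeight q a n)) :=
      Nat.mul_pos (hs n).W_pos (pow_pos (hs n).height_pos _)
    have h2 : 1 < 2 ^ (n + 4) := Nat.one_lt_two_pow (by omega)
    nlinarith
  have hfreq : ∃ᶠ n in atTop, 2 ≤ q n := Frequently.of_forall hq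
  have hq1 : ∀ n, 1 ≤ q n := fun n => (Nat.le_succ 1).trans (hq n)
  obtain ⟨X, mX, sX, μ, hμ, T, hT, F, E, C, H⟩ :=
    exists_isCutAndStack (a := a) (B := 2) hq1 hfreq fun n => by
      have h1 := height_le_of_isBlockStage hs n
      have h2 : (0 : ℝ) ≤ (1 / 2) ^ n * ∏ k ∈ Finset.range n, (q k : ℝ) :=
        mul_nonneg (by positivity) (Finset.prod_nonneg fun _ _ => Nat.cast_nonneg _)
      have h3 : (towerHeight q a n : ℝ) ≤ 2 * ∏ k ∈ Finset.range n, (q k : ℝ) := by linarith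
      exact_mod_cast h3
  refine ⟨X, mX, sX, μ, hμ, T, ⟨hT, q, a, F, E, C, H⟩, ?_⟩
  have hpart : ∀ m, 7 / 8 < μ.real (IsCutAndStack.tower T q a F m) →
      ((δ * (Real.log (towerHeight q a m) / 2) : ℝ) : EReal) ≤ seqEntropy μ T A := by
    intro m hm
    refine le_trans ?_ (le_iSup₂ (f := fun m (ξ : MeasurablePartition (Fin m) X) =>
      seqEntropyPartition μ T A ξ) _ (H.levelPartition m))
    refine le_limsup_of_frequently_le (frequently_atTop.2 fun M => ?_)
    let n := max m M
    let P := (2 ^ (n + 4) + 1) * towerHeight q a n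
    have hP : 0 < P := Nat.mul_pos (Nat.succ_pos _) (hs n).height_pos
    refine ⟨N n P, (le_max_right m M).trans (hnN n P).le, ?_⟩
    have hNpos : (0 : ℝ) < N n P := by exact_mod_cast (Nat.zero_le n).trans_lt (hnN n P)
    have h16 : 16 ≤ 2 ^ (n + 4) := by
      rw [pow_add]
      have := Nat.one_le_two_pow (n := n)
      omega
    have key := H.le_entropy_join hT (hs n) (le_max_left m M) h16 hm.le rfl rfl
      (t := fun k : Fin (N n P) => A k)
      (fun k => (hAD n P k k.isLt).trans (Nat.le_mul_of_pos_right _ hP)) (J := I n P)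
      (hIsep n P)
    rw [EReal.coe_le_coe_iff, le_div_iff₀ hNpos]
    refine le_trans ?_ key
    have hL : 0 ≤ Real.log (towerHeight q a m) / 2 :=
      div_nonneg (Real.log_natCast_nonneg _) zero_le_two
    calc δ * (Real.log (towerHeight q a m) / 2) * N n P
        = δ * N n P * (Real.log (towerHeight q a m) / 2) := by ring
      _ ≤ _ := mul_le_mul_of_nonneg_right (hI n P) hL
  have hlim : Tendsto (fun m => δ * (Real.log (towerHeight q a m) / 2)) atTop atTop :=
    ((Real.tendsto_log_atTop.comp (tendsto_natCast_atTop_atTop.comp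
      (tendsto_towerHeight hq1 hfreq))).atTop_div_const two_pos).const_mul_atTop hδ
  refine EReal.eq_top_iff_forall_lt _ |>.2 fun y => ?_
  obtain ⟨m, hm, hy⟩ := ((H.eventually_lt_measureReal_tower (by norm_num : (7 / 8 : ℝ) < 1)).and
    (hlim.eventually (eventually_gt_atTop y))).exists
  exact (EReal.coe_lt_coe_iff.2 hy).trans_le (hpart m hm)
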